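/- All graphs $\Gamma$ are simplicial graphs with the length metric in which every edge has length $1$. A *cycle* in $\Gamma$ is a closed edge path of positive length (possibly with backtracks and self-intersections), regarded as a map $f\colon C\to\Gamma$ from a circle $C$ subdivided into $|C|$ unit edges. A connected graph $\Gamma$ is *shortcut* if there is a bound on the lengths of its isometrically embedded cycles. It is *strongly shortcut* if, for some $\xi\in(0,1)$, there is a bound on the lengths of the cycles $f\colon C\to\Gamma$ that satisfy $d_\Gamma(f(p),f(q))\ge \xi\,|C|/2$ for every pair of antipodal points $p,q\in C$. A group is (strongly) shortcut if it acts properly and cocompactly by automorphisms on a (strongly) shortcut graph. For $\theta\in\mathbb N$, the *filling* $F_\theta(\Gamma)$ is the $2$-complex with $1$-skeleton $\Gamma$ and one $2$-cell attached along each based oriented cycle of length at most $\theta$. A function $\delta\colon\mathbb N\to\mathbb N$ is an *isodiametric function* of a $2$-complex $X$ if every null-homotopic closed edge path of length at most $n$ in $X$ is the boundary path of a (possibly singular) disk diagram over $X$ whose $1$-skeleton has diameter at most $\delta(n)$. We say that $X$ has an exponential (resp. polynomial) isodiametric function if there are $C,b\in\mathbb N$ (resp. $C,k\in\mathbb N$)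 such that $n\mapsto C\,b^n$ (resp. $n\mapsto C\,n^k+C$) is an isodiametric function of $X$. A group has an exponential (resp. polynomial) isodiametric function if it is finitely presented and the presentation complex of each of its finite presentations has one. **Theorem.** Let $\Gamma$ be a graph. 1. If $\Gamma$ is shortcut then there is $\theta_0\in\mathbb N$ such that, for every $\theta\ge\theta_0$, the filling $F_\theta(\Gamma)$ has an exponential isodiametric function. 2. If $\Gamma$ is strongly shortcut then there is $\theta_0\in\mathbb N$ such that, for every $\theta\ge\theta_0$, the filling $F_\theta(\Gamma)$ has a polynomial isodiametric function. Let $G$ be a group. 3. If $G$ is shortcut then $G$ has an exponential isodiametric function. 4. If $G$ is strongly shortcut then $G$ has a polynomial isodiametric function. -/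

import Mathlib

universe u v

namespace ShortcutGraph

section Cycles

variable {V : Type u} (Γ : SimpleGraph V)

/-! A cycle in a simplicial graph `Γ` is a closed walk `p` of positive length; backtracking and
repeated vertices are allowed. Each edge of `Γ` is a copy of the unit interval and `Γ` carries the
length metric. -/

/-- Distance in the metric graph `Γ` between the point at distance `t` from `a` on the edge `ab`
and the point at distance `s` from `a'` on the edge `a'b'` (with `t, s ∈ [0, 1]`). -/
noncomputable def edgePointDist (a b : V) (t : ℝ) (a' b' : V) (s : ℝ) : ℝ :=
  open Classical in
  if a = a' ∧ b = b' then |t - s|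
  else if a = b' ∧ b = a' then |t - (1 - s)|
  else min (min (t + Γ.dist a a' + s) (t + Γ.dist a b' + (1 - s)))
    (min ((1 - t) + Γ.dist b a' + s) ((1 - t) + Γ.dist b b' + (1 - s)))

variable {Γ}

/-- A closed walk `p` of length `n` is parametrized by arc length by `[0, n)`: the parameter `x`
is the point at distance `Int.fract x` from the start of the edge number `⌊x⌋₊`. This is the
distance in `Γ` between the images of the points of the cycle with parameters `x` and `y`. -/
noncomputable def imageDist {v : V} (p : Γ.Walk v v) (x y : ℝ) : ℝ :=
  edgePointDist Γ (p.getVert ⌊x⌋₊) (p.getVert (⌊x⌋₊ + 1)) (Int.fract x)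
    (p.getVert ⌊y⌋₊) (p.getVert (⌊y⌋₊ + 1)) (Int.fract y)

/-- The length metric of a circle of length `n`, in the parameters `x, y ∈ [0, n)`. -/
noncomputable def circleDist (n : ℕ) (x y : ℝ) : ℝ :=
  min |x - y| (n - |x - y|)

/-- A cycle is isometric if it is an isometric embedding of the (metric) circle `C`. -/
def IsIsometricCycle {v : V} (p : Γ.Walk v v) : Prop :=
  0 < p.length ∧ ∀ x y : ℝ, 0 ≤ x → x < p.length → 0 ≤ y → y < p.length →
    imageDist p x y = circleDist p.length x y

/-- A cycle `f` of length `n` is `ξ`-almost isometric if `d (f p) (f q) ≥ ξ * n / 2` for all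
antipodal points `p, q` of the circle; such pairs are `x, x + n / 2` with `0 ≤ x < n / 2`. -/
def IsAlmostIsometricCycle (ξ : ℝ) {v : V} (p : Γ.Walk v v) : Prop :=
  0 < p.length ∧ ∀ x : ℝ, 0 ≤ x → x < (p.length : ℝ) / 2 →
    ξ * ((p.length : ℝ) / 2) ≤ imageDist p x (x + (p.length : ℝ) / 2)

/-- A connected simplicial graph is shortcut if its isometric cycles have bounded length. -/
def IsShortcut (Γ : SimpleGraph V) : Prop :=
  Γ.Connected ∧ ∃ θ : ℕ, ∀ (v : V) (p : Γ.Walk v v), IsIsometricCycle p → p.length ≤ θ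

/-- A connected simplicial graph is strongly shortcut if, for some `ξ ∈ (0, 1)`, its `ξ`-almost
isometric cycles have bounded length. -/
def IsStronglyShortcut (Γ : SimpleGraph V) : Prop :=
  Γ.Connected ∧ ∃ θ : ℕ, ∃ ξ : ℝ, 0 < ξ ∧ ξ < 1 ∧
    ∀ (v : V) (p : Γ.Walk v v), IsAlmostIsometricCycle ξ p → p.length ≤ θ

end Cycles

section Actions

/-- An action of `G` on the vertices of `Γ` is a proper and cocompact action on the graph `Γ`:
it is by graph automorphisms, stabilizers of vertices are finite, and there are finitely many
orbits of vertices and of edges. -/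
structure IsProperCocompactAction (G : Type u) [Group G] {V : Type v} [MulAction G V]
    (Γ : SimpleGraph V) : Prop where
  adj_smul : ∀ (g : G) {x y : V}, Γ.Adj x y → Γ.Adj (g • x) (g • y)
  finite_stabilizer : ∀ x : V, Finite (MulAction.stabilizer G x)
  cocompact_vertices : ∃ S : Set V, S.Finite ∧ ∀ x : V, ∃ g : G, g • x ∈ S
  cocompact_edges : ∃ S : Set (V × V), S.Finite ∧
    ∀ x y : V, Γ.Adj x y → ∃ g : G, (g • x, g • y) ∈ S

/-- A group is shortcut if it acts properly and cocompactly on a shortcut graph. (By properness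
and cocompactness the vertex set is a finite union of quotients of `G`, so it is no restriction
to take it in the universe of `G`.) -/
def IsShortcutGroup (G : Type u) [Group G] : Prop :=
  ∃ (V : Type u) (_ : MulAction G V) (Γ : SimpleGraph V),
    IsShortcut Γ ∧ IsProperCocompactAction G Γ

/-- A group is strongly shortcut if it acts properly and cocompactly on a strongly shortcut
graph. -/
def IsStronglyShortcutGroup (G : Type u) [Group G] : Prop :=
  ∃ (V : Type u) (_ : MulAction G V) (Γ : SimpleGraph V),
    IsStronglyShortcut Γ ∧ IsProperCocompactAction G Γ

end Actions

/-- A combinatorial 1-complex, given by its vertices and oriented edges (two opposite oriented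
edges for each geometric edge; loops and multiple edges are allowed). -/
structure OneComplex where
  V : Type u
  E : Type u
  src : E → V
  inv : E → E
  inv_inv : ∀ e, inv (inv e) = e
  inv_ne : ∀ e, inv e ≠ e

namespace OneComplex

variable (X : OneComplex.{u})

/-- The endpoint of an oriented edge. -/
def tgt (e : X.E) : X.V := X.src (X.inv e)

/-- `X.IsPath x l y`: the list `l` of oriented edges is an edge path from `x` to `y`. -/
def IsPath : X.V → List X.E → X.V → Prop
  | x, [], y => x = y
  | x, e :: l, y => X.src e = x ∧ IsPath (X.tgt e) l y

/-- The reversed edge path. -/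
def reversePath (l : List X.E) : List X.E := (l.map X.inv).reverse

/-- Orientation reversal as a permutation of the oriented edges. -/
def invPerm : Equiv.Perm X.E := Function.Involutive.toPerm X.inv X.inv_inv

end OneComplex

/-- A combinatorial 2-complex: a 1-complex with 2-cells attached along closed edge paths. -/
structure TwoComplex extends OneComplex.{u} where
  Cell : Type u
  bdry : Cell → List E
  bdry_closed : ∀ c, ∃ x, toOneComplex.IsPath x (bdry c) x

namespace TwoComplex

variable (X : TwoComplex.{u})

/-- An elementary homotopy of closed edge paths based at `x`: insertion of a backtrack or of the
boundary of a 2-cell. -/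
def HomotopyStep (x : X.V) (l l' : List X.E) : Prop :=
  X.IsPath x l x ∧ X.IsPath x l' x ∧ ∃ p q r : List X.E, l = p ++ q ∧ l' = p ++ r ++ q ∧
    ((∃ e : X.E, r = [e, X.inv e]) ∨ ∃ c : X.Cell, r = X.bdry c)

/-- A closed edge path based at `x` is null-homotopic if elementary homotopies and their inverses
transform it into the constant path. -/
def NullHomotopic (x : X.V) (l : List X.E) : Prop :=
  Relation.EqvGen (X.HomotopyStep x) l []

end TwoComplex

/-- The 2-complex `F_θ(Γ)`: its 1-skeleton is `Γ`, and it has one 2-cell attached along each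
(based, oriented) cycle of `Γ` of length at most `θ`. -/
def filling {V : Type u} (Γ : SimpleGraph V) (θ : ℕ) : TwoComplex.{u} where
  V := V
  E := Γ.Dart
  src e := e.fst
  inv e := e.symm
  inv_inv e := e.symm_symm
  inv_ne e := e.symm_ne
  Cell := Σ v : V, {p : Γ.Walk v v // 0 < p.length ∧ p.length ≤ θ}
  bdry c := c.2.1.darts
  bdry_closed := by
    rintro ⟨v, p, -⟩
    refine ⟨v, ?_⟩
    have key : ∀ {a b : V} (q : Γ.Walk a b),
        OneComplex.IsPath ⟨V, Γ.Dart, fun e => e.fst, fun e => e.symm, fun e => e.symm_symm,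
          fun e => e.symm_ne⟩ a q.darts b := by
      intro a b q
      induction q with
      | nil => exact rfl
      | cons h q ih => exact ⟨rfl, ih⟩
    exact key p

/-- The presentation complex of `⟨x₁, …, xₙ | rels⟩`: one vertex, one geometric edge for each
generator (the oriented edge `(i, true)` stands for `xᵢ` and `(i, false)` for its inverse), and one
2-cell for each relator, attached along the reduced word of the relator. -/
def presentationComplex {n : ℕ} (rels : Set (FreeGroup (Fin n))) : TwoComplex.{0} where
  V := Unit
  E := Fin n × Bool
  src _ := ()
  inv e := (e.1, !e.2)
  inv_inv e := by simp
  inv_ne e h := by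
    have := congrArg Prod.snd h
    simp at this
  Cell := rels
  bdry r := r.1.toWord
  bdry_closed r := by
    refine ⟨(), ?_⟩
    generalize r.1.toWord = l
    induction l with
    | nil => exact rfl
    | cons e l ih => exact ⟨rfl, ih⟩

/-- A (possibly singular) disk diagram over `X`, i.e. a combinatorial map `D → X` from a finite
contractible planar 2-complex `D`. Such a `D` is a finite connected graph drawn in the sphere with
all complementary faces but one, the outer face, filled in by 2-cells. The drawing is given as a
combinatorial map: `next e` is the oriented edge after `e` on the boundary of the face on a fixed
side of `e`; faces are the cycles of `next`; vertices correspond to the cycles of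
`e ↦ next (inv e)`; the surface so described is the sphere by Euler's formula. The marked oriented
edge `outer` lies on the boundary of the outer face and determines the base point of the boundary
path of `D`. (The diagram consisting of a single vertex, whose boundary path is constant, is
excluded.) -/
structure DiskDiagram (X : TwoComplex.{u}) extends OneComplex.{0} where
  finite_V : Finite V
  finite_E : Finite E
  next : Equiv.Perm E
  src_next : ∀ e, src (next e) = toOneComplex.tgt e
  sameCycle_of_src_eq : ∀ e e', src e = src e' →
    (next * toOneComplex.invPerm).SameCycle e e'
  connected : ∀ x y, ∃ l, toOneComplex.IsPath x l y
  euler : 2 * Nat.card V + 2 * Nat.card (Quotient (Equiv.Perm.SameCycle.setoid next)) =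
    Nat.card E + 4
  outer : E
  mapV : V → X.V
  mapE : E → X.E
  map_src : ∀ e, mapV (src e) = X.src (mapE e)
  map_inv : ∀ e, mapE (inv e) = X.inv (mapE e)
  /-- Every face other than the outer one is a 2-cell mapped onto a 2-cell of `X`: from a suitable
  starting edge, its boundary path maps to the attaching path of that cell or to its reverse. -/
  face_map : ∀ e, ¬ next.SameCycle outer e → ∃ e', next.SameCycle e e' ∧ ∃ c : X.Cell,
    (List.iterate next e' (Function.minimalPeriod next e')).map mapE = X.bdry c ∨
    (List.iterate next e' (Function.minimalPeriod next e')).map mapE =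
      X.reversePath (X.bdry c)

namespace DiskDiagram

variable {X : TwoComplex.{u}} (D : DiskDiagram X)

/-- The boundary path of the outer face of the diagram, starting with the edge `outer`, mapped
to `X`. -/
noncomputable def boundaryPath : List X.E :=
  (List.iterate D.next D.outer (Function.minimalPeriod D.next D.outer)).map D.mapE

/-- The diameter of (the 1-skeleton of) the diagram is at most `m`. -/
def DiamLE (m : ℕ) : Prop :=
  ∀ x y : D.V, ∃ l : List D.E, D.IsPath x l y ∧ l.length ≤ m

end DiskDiagram

/-- `f` is an isodiametric function of `X`: every null-homotopic closed edge path of length at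
most `n` bounds a disk diagram of diameter at most `f n`. (For the constant path the diagram is a
single vertex and nothing is required.) -/
def IsIsodiametricFunction (X : TwoComplex.{u}) (f : ℕ → ℕ) : Prop :=
  ∀ (n : ℕ) (x : X.V) (l : List X.E), l ≠ [] → l.length ≤ n → X.IsPath x l x →
    X.NullHomotopic x l → ∃ D : DiskDiagram X, D.boundaryPath = l ∧ D.DiamLE (f n)

/-- `X` has an exponential isodiametric function. -/
def HasExponentialIsodiametricFunction (X : TwoComplex.{u}) : Prop :=
  ∃ C b : ℕ, IsIsodiametricFunction X (fun n => C * b ^ n)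

/-- `X` has a polynomial isodiametric function. -/
def HasPolynomialIsodiametricFunction (X : TwoComplex.{u}) : Prop :=
  ∃ C k : ℕ, IsIsodiametricFunction X (fun n => C * n ^ k + C)

/-- `⟨x₁, …, xₙ | rels⟩` is a finite presentation of the group `G`. -/
def IsFinitePresentation (G : Type u) [Group G] {n : ℕ} (rels : Set (FreeGroup (Fin n))) : Prop :=
  rels.Finite ∧ Nonempty (PresentedGroup rels ≃* G)

/-- `G` has an exponential isodiametric function: it is finitely presented and each of its finite
presentations has an exponential isodiametric function. -/
def GroupHasExponentialIsodiametricFunction (G : Type u) [Group G] : Prop :=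
  Group.IsFinitelyPresented G ∧
  ∀ (n : ℕ) (rels : Set (FreeGroup (Fin n))), IsFinitePresentation G rels →
    HasExponentialIsodiametricFunction (presentationComplex rels)

/-- `G` has a polynomial isodiametric function: it is finitely presented and each of its finite
presentations has a polynomial isodiametric function. -/
def GroupHasPolynomialIsodiametricFunction (G : Type u) [Group G] : Prop :=
  Group.IsFinitelyPresented G ∧
  ∀ (n : ℕ) (rels : Set (FreeGroup (Fin n))), IsFinitePresentation G rels →
    HasPolynomialIsodiametricFunction (presentationComplex rels)

end ShortcutGraph

/-! Shortcut alone already gives quadratic isodiametric functions. Strongly shortcut graphs are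
shortcut (`IsStronglyShortcut.isShortcut`), and polynomial bounds imply exponential ones, so all
four claims follow.

The geometric core is `walkProd_mem_closure`. A closed walk longer than `θ` is not isometric, so two
of its vertices are joined by a geodesic shorter than both arcs between them. This chord cuts the
walk into two strictly shorter closed walks, one of them conjugated by an initial segment of the
walk. Iterating, a closed walk of length `n` becomes a product of conjugates of closed walks of
length at most `θ`. Each round lengthens the conjugators by less than the current length, so they
stay below `n ^ 2`. The number of factors may be huge, but it does not affect diameters.

That last point is van Kampen's lemma in the form `exists_diskDiagram_of_mem_closure`. A conjugate
of a cell is a lollipop, and a wedge of lollipops at the base point has the radius of the largest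
one. To the spike with boundary `l l⁻¹` one wedges lollipops with total boundary `s`, freely equal
to `l`. Folding `l⁻¹ s` away leaves boundary `l`. Folding, and discarding the spheres pinched off on
the way, moves no surviving vertex further from the base point.

Planarity is treated algebraically. A map on a surface is a pair of permutations `next`, `inv`.
Gluing and cutting multiply `next` by a transposition, and closing a bigon changes `inv` by two
transpositions. A transposition merges or splits cycles, so faces, vertices and components can be
counted throughout and compared by Euler's inequality (`numCycles_add_numCycles_mul_le`). Maps may
become disconnected; the component of the base point is extracted at the very end
(`euler_of_component`).

For groups, `IsShortcut.exists_finite_relators` carries the core over to a surjection from a free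
group. Words are shadowed by walks in the graph through a coarse inverse of the orbit map, and short
closed walks lift to relators of bounded length. Passing to the relators of any other finite
presentation adds a constant to the conjugators (`exists_closure_boundedConj_le`). -/

namespace ShortcutGraph

/-! ### Cycles of permutations and Euler's inequality -/

section Counting

open Equiv

variable {E : Type*}

/-- The number of classes of the equivalence relation generated by `r`. -/
noncomputable def numClasses (r : E → E → Prop) : ℕ := Nat.card (Quot r)

theorem numClasses_le_of_forall [Finite E] {r s : E → E → Prop}
    (h : ∀ x y, r x y → Quot.mk s x = Quot.mk s y) : numClasses s ≤ numClasses r := by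
  refine Nat.card_le_card_of_surjective (Quot.lift (Quot.mk s) h) ?_
  rintro ⟨x⟩
  exact ⟨Quot.mk r x, rfl⟩

theorem numClasses_congr [Finite E] {r s : E → E → Prop}
    (h : ∀ x y, r x y → Quot.mk s x = Quot.mk s y)
    (h' : ∀ x y, s x y → Quot.mk r x = Quot.mk r y) : numClasses r = numClasses s :=
  le_antisymm (numClasses_le_of_forall h') (numClasses_le_of_forall h)

/-- The relation `r` together with the pair `(a, b)`. -/
def withPair (r : E → E → Prop) (a b : E) (x y : E) : Prop := r x y ∨ (x = a ∧ y = b)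

theorem numClasses_withPair_of_eq [Finite E] {r : E → E → Prop} {a b : E}
    (h : Quot.mk r a = Quot.mk r b) : numClasses (withPair r a b) = numClasses r := by
  refine numClasses_congr ?_ fun x y hxy => Quot.sound (Or.inl hxy)
  rintro x y (hxy | ⟨rfl, rfl⟩)
  exacts [Quot.sound hxy, h]

/-- The class of `b` is absorbed into that of `a`, so the new quotient is in bijection with the old
one minus the class of `b`. -/
theorem numClasses_withPair_of_ne [Finite E] {r : E → E → Prop} {a b : E}
    (h : Quot.mk r a ≠ Quot.mk r b) : numClasses (withPair r a b) + 1 = numClasses r := by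
  classical
  let f : Quot (withPair r a b) → Quot r :=
    Quot.lift (fun x => if Quot.mk r x = Quot.mk r b then Quot.mk r a else Quot.mk r x) (by
      rintro x y (hxy | ⟨rfl, rfl⟩)
      · simp only [Quot.sound hxy]
      · simp)
  let g : Quot r → Quot (withPair r a b) :=
    Quot.lift (Quot.mk _) fun x y hxy => Quot.sound (Or.inl hxy)
  have hab : g (Quot.mk r a) = g (Quot.mk r b) := Quot.sound (Or.inr ⟨rfl, rfl⟩)
  have hgf : Function.LeftInverse g f := by
    rintro ⟨x⟩
    by_cases hx : Quot.mk r x = Quot.mk r b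
    · have : f (Quot.mk _ x) = Quot.mk r a := if_pos hx
      rw [this, hab, ← hx]
    · have : f (Quot.mk _ x) = Quot.mk r x := if_neg hx
      rw [this]
  have hrange : Set.range f = {Quot.mk r b}ᶜ := by
    ext c
    induction c using Quot.ind with | mk x =>
    simp only [Set.mem_range, Set.mem_compl_iff, Set.mem_singleton_iff]
    constructor
    · rintro ⟨⟨y⟩, hy⟩ hx
      by_cases hyb : Quot.mk r y = Quot.mk r b
      · exact h (((if_pos hyb).symm.trans hy).trans hx)
      · exact hyb (((if_neg hyb).symm.trans hy).trans hx)
    · intro hx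
      exact ⟨Quot.mk _ x, if_neg hx⟩
  have h1 := Nat.card_range_of_injective hgf.injective
  have h2 := Set.ncard_add_ncard_compl ({Quot.mk r b} : Set (Quot r))
  rw [Set.ncard_singleton, ← hrange, ← Nat.card_coe_set_eq, h1] at h2
  unfold numClasses
  omega

theorem numClasses_le_withPair_add_one [Finite E] (r : E → E → Prop) (a b : E) :
    numClasses r ≤ numClasses (withPair r a b) + 1 := by
  by_cases h : Quot.mk r a = Quot.mk r b
  · have := numClasses_withPair_of_eq h
    omega
  · have := numClasses_withPair_of_ne h
    omega

/-- The number of cycles (including fixed points) of a permutation. -/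
noncomputable def numCycles (g : Perm E) : ℕ := numClasses fun x y => y = g x

theorem mk_eq_mk_iff_sameCycle {g : Perm E} {x y : E} :
    Quot.mk (fun x y => y = g x) x = Quot.mk (fun x y => y = g x) y ↔ g.SameCycle x y := by
  constructor
  · intro h
    induction Quot.eqvGen_exact h with
    | rel x y h' => rw [h']; exact (Perm.SameCycle.refl g x).apply_right
    | refl => exact Perm.SameCycle.refl _ _
    | symm _ _ _ ih => exact (ih h.symm).symm
    | trans _ _ _ h1 h2 ih1 ih2 =>
      exact (ih1 (Quot.eqvGen_sound h1)).trans (ih2 (Quot.eqvGen_sound h2))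
  · have key : ∀ (n : ℕ) (x : E),
        Quot.mk (fun x y => y = g x) x = Quot.mk (fun x y => y = g x) ((g ^ n) x) := by
      intro n x
      induction n with
      | zero => rfl
      | succ n ih =>
        rw [ih]
        exact Quot.sound (by rw [pow_succ']; rfl)
    rintro ⟨i, rfl⟩
    obtain ⟨n, rfl | rfl⟩ := i.eq_nat_or_neg
    · exact_mod_cast key n x
    · rw [key n ((g ^ (-(n : ℤ))) x)]
      simp

theorem numCycles_eq_card (g : Perm E) :
    numCycles g = Nat.card (Quotient (Perm.SameCycle.setoid g)) := by
  refine Nat.card_congr ⟨Quot.lift (Quotient.mk _) ?_, Quotient.lift (Quot.mk _) ?_, ?_, ?_⟩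
  · intro x y h
    exact Quotient.sound (mk_eq_mk_iff_sameCycle.1 (Quot.sound h))
  · intro x y h
    exact mk_eq_mk_iff_sameCycle.2 h
  · rintro ⟨x⟩; rfl
  · rintro ⟨x⟩; rfl

/-- Until its first return to `{a, b}`, the forward orbit of `b` under `g` does not feel the swap,
and `g * swap a b` sends `a` onto it. Whether that return is to `a` or to `b` decides how the cycles
change. -/
theorem exists_first_hit [Finite E] [DecidableEq E] (g : Perm E) (a b : E) :
    ∃ k : ℕ, ((g ^ (k + 1)) b = a ∨ (g ^ (k + 1)) b = b) ∧
      (∀ i < k, (g ^ (i + 1)) b ≠ a ∧ (g ^ (i + 1)) b ≠ b) ∧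
      ∀ i ≤ k, ((g * swap a b) ^ (i + 1)) a = (g ^ (i + 1)) b := by
  classical
  have hex : ∃ k : ℕ, (g ^ (k + 1)) b = a ∨ (g ^ (k + 1)) b = b := by
    refine ⟨orderOf g - 1, Or.inr ?_⟩
    rw [Nat.sub_add_cancel (orderOf_pos g), pow_orderOf_eq_one]
    rfl
  have hmin : ∀ i < Nat.find hex, (g ^ (i + 1)) b ≠ a ∧ (g ^ (i + 1)) b ≠ b :=
    fun i hi => not_or.1 (Nat.find_min hex hi)
  refine ⟨Nat.find hex, Nat.find_spec hex, hmin, ?_⟩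
  intro i
  induction i with
  | zero => intro _; simp
  | succ i ih =>
    intro hi
    have hn := hmin i (by omega)
    rw [pow_succ', Perm.mul_apply, ih (by omega), Perm.mul_apply, swap_apply_of_ne_of_ne hn.1 hn.2,
      ← Perm.mul_apply, ← pow_succ']

theorem exists_lt_pow_eq_of_sameCycle [Finite E] {g : Perm E} {x y : E} {n : ℕ} (hn : 0 < n)
    (hx : (g ^ n) x = x) (h : g.SameCycle x y) : ∃ i < n, (g ^ i) x = y := by
  obtain ⟨j, hj⟩ := h.exists_nat_pow_eq
  refine ⟨j % n, Nat.mod_lt _ hn, ?_⟩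
  have hp : Function.IsPeriodicPt g n x := by
    rw [Function.IsPeriodicPt, Function.IsFixedPt, Perm.iterate_eq_pow, hx]
  have := hp.iterate_mod_apply j
  rwa [Perm.iterate_eq_pow, Perm.iterate_eq_pow, hj] at this

/-- If the first return is to `a`, then `a` and `b` share a `g`-cycle, while the new orbit of `a`
closes up before meeting `b`. If it is to `b`, the `g`-cycle of `b` misses `a`, and `b` lies on the
new orbit of `a`. -/
theorem sameCycle_mul_swap_iff [Finite E] [DecidableEq E] {g : Perm E} {a b : E} (hab : a ≠ b) :
    (g * swap a b).SameCycle a b ↔ ¬ g.SameCycle a b := by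
  obtain ⟨k, hk, hmin, hi⟩ := exists_first_hit g a b
  constructor
  · intro h h'
    rcases hk with hk | hk
    · obtain ⟨i, hik, hib⟩ := exists_lt_pow_eq_of_sameCycle k.succ_pos ((hi k le_rfl).trans hk) h
      rcases i with - | i
      · exact hab hib
      · rw [hi i (by omega)] at hib
        exact (hmin i (by omega)).2 hib
    · obtain ⟨i, hik, hib⟩ := exists_lt_pow_eq_of_sameCycle k.succ_pos hk h'.symm
      rcases i with - | i
      · exact hab hib.symm
      · exact (hmin i (by omega)).1 hib
  · intro h
    rcases hk with hk | hk
    · refine absurd (Perm.SameCycle.symm (x := b) (y := a) ?_) h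
      exact ⟨((k + 1 : ℕ) : ℤ), by rw [zpow_natCast, hk]⟩
    · exact ⟨((k + 1 : ℕ) : ℤ), by rw [zpow_natCast, hi k le_rfl, hk]⟩

/-- Once `a` and `b` count as one class, swapping them before applying `g` changes nothing. This
gives a common value with which the cycle counts before and after the swap are compared. -/
theorem numClasses_withPair_mul_swap [Finite E] [DecidableEq E] (g : Perm E) (a b : E) :
    numClasses (withPair (fun x y => y = (g * swap a b) x) a b) =
      numClasses (withPair (fun x y => y = g x) a b) := by
  have key : ∀ g : Perm E, ∀ x y, withPair (fun x y => y = (g * swap a b) x) a b x y →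
      Quot.mk (withPair (fun x y => y = g x) a b) x = Quot.mk _ y := by
    intro g
    have hab : Quot.mk (withPair (fun x y => y = g x) a b) a = Quot.mk _ b :=
      Quot.sound (Or.inr ⟨rfl, rfl⟩)
    have hg : ∀ x, Quot.mk (withPair (fun x y => y = g x) a b) (g x) = Quot.mk _ x :=
      fun x => Eq.symm (Quot.sound (Or.inl rfl : withPair (fun x y => y = g x) a b x (g x)))
    rintro x y (rfl | ⟨rfl, rfl⟩)
    · rw [Perm.mul_apply, hg, swap_apply_def]
      split_ifs with h1 h2
      · rw [h1, hab]
      · rw [h2, hab]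
      · rfl
    · exact hab
  refine numClasses_congr (key g) ?_
  have := key (g * swap a b)
  rwa [mul_assoc, swap_mul_self, mul_one] at this

theorem numCycles_mul_swap_of_sameCycle [Finite E] [DecidableEq E] {g : Perm E} {a b : E} (hab : a ≠ b)
    (h : g.SameCycle a b) : numCycles (g * swap a b) = numCycles g + 1 := by
  have h1 := numClasses_withPair_of_eq (mk_eq_mk_iff_sameCycle.2 h)
  have h2 := numClasses_withPair_of_ne
    (fun h' => (sameCycle_mul_swap_iff hab).1 (mk_eq_mk_iff_sameCycle.1 h') h)
  rw [numClasses_withPair_mul_swap, h1] at h2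
  exact h2.symm

theorem numCycles_mul_swap_of_not_sameCycle [Finite E] [DecidableEq E] {g : Perm E} {a b : E}
    (h : ¬ g.SameCycle a b) : numCycles (g * swap a b) + 1 = numCycles g := by
  have hab : a ≠ b := fun hab => h (hab ▸ Perm.SameCycle.refl _ _)
  have := numCycles_mul_swap_of_sameCycle hab ((sameCycle_mul_swap_iff hab).2 h)
  rw [mul_assoc, swap_mul_self, mul_one] at this
  exact this.symm

theorem numCycles_mul_swap_le [Finite E] [DecidableEq E] (g : Perm E) (a b : E) :
    numCycles (g * swap a b) ≤ numCycles g + 1 := by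
  by_cases hab : a = b
  · subst hab
    rw [swap_self, ← Perm.one_def, mul_one]
    omega
  by_cases h : g.SameCycle a b
  · exact (numCycles_mul_swap_of_sameCycle hab h).le
  · have := numCycles_mul_swap_of_not_sameCycle h
    omega

/-- The relation whose classes are the connected components of the map `(g, i)`. -/
def mapRel (g i : Perm E) (x y : E) : Prop := y = g x ∨ y = i x

theorem mapRel_mk_left (g i : Perm E) (x : E) :
    Quot.mk (mapRel g i) (g x) = Quot.mk (mapRel g i) x := 
  Eq.symm (Quot.sound (Or.inl rfl : mapRel g i x (g x)))

theorem mapRel_mk_right (g i : Perm E) (x : E) :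
    Quot.mk (mapRel g i) (i x) = Quot.mk (mapRel g i) x :=
  Eq.symm (Quot.sound (Or.inr rfl : mapRel g i x (i x)))

theorem mapRel_mk_eq_of_sameCycle {g i : Perm E} {x y : E} (h : g.SameCycle x y) :
    Quot.mk (mapRel g i) x = Quot.mk (mapRel g i) y := by
  have := mk_eq_mk_iff_sameCycle.2 h
  exact congrArg (Quot.lift (Quot.mk (mapRel g i)) fun x y h => Quot.sound (Or.inl h)) this

theorem mapRel_mk_eq_of_sameCycle_mul {g i : Perm E} {x y : E} (h : (g * i).SameCycle x y) :
    Quot.mk (mapRel g i) x = Quot.mk (mapRel g i) y := by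
  have := mk_eq_mk_iff_sameCycle.2 h
  refine congrArg (Quot.lift (Quot.mk (mapRel g i)) fun x y h => ?_) this
  rw [h, Perm.mul_apply, mapRel_mk_left, mapRel_mk_right]

/-- Induction on the number of edges. The darts of a deleted edge stay as fixed points of `i`, so
fixed points must be allowed here. Without edges, equality holds. Restoring an edge between two
components loses one vertex cycle and one component, and both sides drop by 2; restoring one inside
a component gains at most one vertex cycle, and the right side grows by 2. -/
theorem numCycles_add_numCycles_mul_le_aux [Finite E] (g : Perm E) (n : ℕ) :
    ∀ i : Perm E, (∀ x, i (i x) = x) → {x | i x ≠ x}.ncard ≤ 2 * n →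
      2 * numCycles g + 2 * numCycles (g * i) ≤
        {x | i x ≠ x}.ncard + 4 * numClasses (mapRel g i) := by
  classical
  induction n with
  | zero =>
    intro i _ hn
    have hi : i = 1 := by
      ext x
      by_contra hx
      have : x ∈ ({x | i x ≠ x} : Set E) := hx
      rw [Nat.le_zero.1 hn |> (Set.ncard_eq_zero (Set.toFinite _)).1] at this
      exact this
    subst hi
    have : numClasses (mapRel g 1) = numCycles g := by
      refine numClasses_congr ?_ fun x y h => Quot.sound (Or.inl h)
      rintro x y (h | h)
      · exact Quot.sound h
      · rw [h]; rfl
    rw [mul_one, this]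
    omega
  | succ n ih =>
    intro i hi hn
    by_cases hfix : ∀ x, i x = x
    · have := ih i hi (by simp [hfix])
      omega
    push Not at hfix
    obtain ⟨x, hx⟩ := hfix
    have hval : ∀ y, (i * swap x (i x)) y = if y = x ∨ y = i x then y else i y := by
      intro y
      rw [Perm.mul_apply, swap_apply_def]
      split_ifs <;> simp_all
    have hcard : ({y | (i * swap x (i x)) y ≠ y} : Set E).ncard + 2 = {y | i y ≠ y}.ncard := by
      have hsub : ({y | (i * swap x (i x)) y ≠ y} : Set E) = {y | i y ≠ y} \ {x, i x} := by
        ext y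
        simp only [Set.mem_ofPred_eq, hval, Set.mem_sdiff, Set.mem_insert_iff,
          Set.mem_singleton_iff]
        split_ifs <;> simp_all
      have h2 : ({x, i x} : Set E).ncard = 2 := Set.ncard_pair (Ne.symm hx)
      have hle : ({x, i x} : Set E) ⊆ {y | i y ≠ y} := by
        rintro y (rfl | rfl)
        · exact hx
        · simpa [hi] using Ne.symm hx
      have h3 := Set.ncard_le_ncard hle (Set.toFinite _)
      rw [hsub, Set.ncard_sdiff hle (Set.toFinite _), h2]
      omega
    have hinv : ∀ y, (i * swap x (i x)) ((i * swap x (i x)) y) = y := by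
      intro y
      rw [hval, hval]
      split_ifs with h1 h3
      · rfl
      · exfalso
        rcases h3 with h3 | h3
        · exact h1 (Or.inr (by rw [← h3, hi]))
        · exact h1 (Or.inl (i.injective h3))
      · exact hi y
    have IH := ih _ hinv (by omega)
    -- `j` is `i` with the edge `{x, i x}` deleted.
    set j := i * swap x (i x) with hj
    have hij : i = j * swap x (i x) := by rw [hj, mul_assoc, swap_mul_self, mul_one]
    have hcl : numClasses (withPair (mapRel g j) x (i x)) = numClasses (mapRel g i) := by
      refine numClasses_congr ?_ ?_
      · rintro y z ((rfl | rfl) | ⟨rfl, rfl⟩)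
        · exact (mapRel_mk_left g i y).symm
        · rw [hval]
          split_ifs with h
          · rfl
          · exact (mapRel_mk_right g i y).symm
        · exact (mapRel_mk_right g i _).symm
      · rintro y z (rfl | rfl)
        · exact Quot.sound (Or.inl (Or.inl rfl))
        · have hp : Quot.mk (withPair (mapRel g j) x (i x)) x = Quot.mk _ (i x) :=
            Quot.sound (Or.inr ⟨rfl, rfl⟩)
          by_cases h : y = x ∨ y = i x
          · rcases h with rfl | rfl
            · exact hp
            · rw [hi, hp]
          · refine Quot.sound (Or.inl (Or.inr ?_))
            rw [hval, if_neg h]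
    have hgi : g * i = g * j * swap x (i x) := by rw [mul_assoc, ← hij]
    by_cases hc : Quot.mk (mapRel g j) x = Quot.mk (mapRel g j) (i x)
    · have h1 := numClasses_withPair_of_eq hc
      have h2 := numCycles_mul_swap_le (g * j) x (i x)
      rw [hgi]
      omega
    · have h1 := numClasses_withPair_of_ne hc
      have h2 := numCycles_mul_swap_of_not_sameCycle (g := g * j) (a := x) (b := i x)
        fun h => hc (mapRel_mk_eq_of_sameCycle_mul h)
      rw [hgi]
      omega

/-- Euler's inequality for the map with faces the cycles of `g` and edges the cycles of the
involution `i`. -/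
theorem numCycles_add_numCycles_mul_le [Finite E] (g i : Perm E) (hi : ∀ x, i (i x) = x)
    (hne : ∀ x, i x ≠ x) :
    2 * numCycles g + 2 * numCycles (g * i) ≤ Nat.card E + 4 * numClasses (mapRel g i) := by
  have := numCycles_add_numCycles_mul_le_aux g {x | i x ≠ x}.ncard i hi (by omega)
  have h2 : {x | i x ≠ x} = Set.univ := Set.eq_univ_of_forall hne
  rwa [h2, Set.ncard_univ] at this

end Counting

/-! ### Effect of a transposition on the genus of a map -/

section CyclesOfMaps

open Equiv

variable {E F : Type*}

theorem numClasses_equiv (f : E ≃ F) {r : E → E → Prop} {s : F → F → Prop}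
    (h : ∀ x y, r x y ↔ s (f x) (f y)) : numClasses r = numClasses s :=
  Nat.card_congr (Quot.congr f h)

theorem numCycles_equiv (f : E ≃ F) {g : Perm E} {h : Perm F} (hgh : ∀ x, f (g x) = h (f x)) :
    numCycles g = numCycles h := by
  refine numClasses_equiv f fun x y => ?_
  rw [← hgh, f.injective.eq_iff]

theorem numClasses_mapRel_equiv (f : E ≃ F) {g i : Perm E} {h j : Perm F}
    (hgh : ∀ x, f (g x) = h (f x)) (hij : ∀ x, f (i x) = j (f x)) :
    numClasses (mapRel g i) = numClasses (mapRel h j) := by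
  refine numClasses_equiv f fun x y => ?_
  rw [mapRel, mapRel, ← hgh, ← hij, f.injective.eq_iff, f.injective.eq_iff]

theorem numClasses_liftRel [Finite E] [Finite F] (r : E → E → Prop) (s : F → F → Prop) :
    numClasses (Sum.LiftRel r s) = numClasses r + numClasses s := by
  unfold numClasses
  rw [← Nat.card_sum]
  refine Nat.card_congr ⟨Quot.lift (Sum.map (Quot.mk r) (Quot.mk s)) ?_,
    Sum.elim (Quot.lift (fun x => Quot.mk _ (Sum.inl x)) ?_)
      (Quot.lift (fun x => Quot.mk _ (Sum.inr x)) ?_), ?_, ?_⟩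
  · rintro _ _ (h | h)
    · exact congrArg Sum.inl (Quot.sound h)
    · exact congrArg Sum.inr (Quot.sound h)
  · exact fun x y h => Quot.sound (Sum.LiftRel.inl h)
  · exact fun x y h => Quot.sound (Sum.LiftRel.inr h)
  · rintro ⟨x | x⟩ <;> rfl
  · rintro (x | x) <;> induction x using Quot.ind <;> rfl

theorem numCycles_sumCongr [Finite E] [Finite F] (g : Perm E) (h : Perm F) :
    numCycles (Perm.sumCongr g h) = numCycles g + numCycles h := by
  unfold numCycles
  rw [← numClasses_liftRel]
  congr 1
  ext (x | x) (y | y) <;> simp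

theorem numClasses_mapRel_sumCongr [Finite E] [Finite F] (g i : Perm E) (h j : Perm F) :
    numClasses (mapRel (Perm.sumCongr g h) (Perm.sumCongr i j)) =
      numClasses (mapRel g i) + numClasses (mapRel h j) := by
  rw [← numClasses_liftRel]
  congr 1
  ext (x | x) (y | y) <;> simp [mapRel]

theorem mapRel_sumCongr_mk_ne (g i : Perm E) (h j : Perm F) (x : E) (y : F) :
    Quot.mk (mapRel (Perm.sumCongr g h) (Perm.sumCongr i j)) (Sum.inl x) ≠
      Quot.mk _ (Sum.inr y) := by
  intro hxy
  have := congrArg (Quot.lift (Sum.isLeft) (by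
    rintro (x | x) y (rfl | rfl) <;> rfl)) hxy
  simp at this

theorem numClasses_withPair_mapRel_mul_swap [Finite E] [DecidableEq E] (g i : Perm E) (a b : E) :
    numClasses (withPair (mapRel (g * swap a b) i) a b) =
      numClasses (withPair (mapRel g i) a b) := by
  have key : ∀ g : Perm E, ∀ x y, withPair (mapRel (g * swap a b) i) a b x y →
      Quot.mk (withPair (mapRel g i) a b) x = Quot.mk _ y := by
    intro g
    have hab : Quot.mk (withPair (mapRel g i) a b) a = Quot.mk _ b :=
      Quot.sound (Or.inr ⟨rfl, rfl⟩)
    have hg : ∀ x, Quot.mk (withPair (mapRel g i) a b) (g x) = Quot.mk _ x :=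
      fun x => Eq.symm (Quot.sound (Or.inl (Or.inl rfl) : withPair (mapRel g i) a b x (g x)))
    rintro x y ((rfl | rfl) | ⟨rfl, rfl⟩)
    · rw [Perm.mul_apply, hg, swap_apply_def]
      split_ifs with h1 h2
      · rw [h1, hab]
      · rw [h2, hab]
      · rfl
    · exact Quot.sound (Or.inl (Or.inr rfl))
    · exact hab
  refine numClasses_congr (key g) ?_
  have := key (g * swap a b)
  rwa [mul_assoc, swap_mul_self, mul_one] at this

/-- Turns a transposition of the face permutation into one of the vertex permutation `g * i`: the
darts `i a` and `i b` start where `a` and `b` end. -/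
theorem swap_mul_involution [DecidableEq E] {i : Perm E} (hi : ∀ x, i (i x) = x) (a b : E) :
    swap a b * i = i * swap (i a) (i b) := by
  have : i⁻¹ = i := by
    ext x
    rw [Perm.inv_eq_iff_eq, hi]
  have h := swap_apply_apply i a b
  rw [this] at h
  rw [h, mul_assoc, ← mul_assoc i i]
  have : i * i = 1 := by ext x; exact hi x
  rw [this, one_mul]

/-- Multiplying the face permutation of a planar map by a transposition of two elements of the same
face, or of distinct components, gives a planar map. -/
theorem genus_mul_swap [Finite E] [DecidableEq E] {g i : Perm E} (hi : ∀ x, i (i x) = x)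
    {N : ℕ} (hN : N + 4 * numClasses (mapRel g i) ≤ 2 * numCycles g + 2 * numCycles (g * i))
    {a b : E} (hab : a ≠ b)
    (h : g.SameCycle a b ∨ Quot.mk (mapRel g i) a ≠ Quot.mk (mapRel g i) b) :
    N + 4 * numClasses (mapRel (g * swap a b) i) ≤
      2 * numCycles (g * swap a b) + 2 * numCycles (g * swap a b * i) := by
  have hs : g * swap a b * i = g * i * swap (i a) (i b) := by
    rw [mul_assoc, swap_mul_involution hi, mul_assoc]
  have hc := numClasses_withPair_mapRel_mul_swap g i a b
  have hle := numClasses_le_withPair_add_one (mapRel (g * swap a b) i) a b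
  have hi' : i a ≠ i b := fun h => hab (i.injective h)
  rw [hs]
  rcases h with h | h
  · have h1 := numCycles_mul_swap_of_sameCycle hab h
    rw [numClasses_withPair_of_eq (mapRel_mk_eq_of_sameCycle h)] at hc
    -- In both cases one face is gained. If `a` and `b` end at the same vertex, it splits and at
    -- most one component is gained; otherwise two vertices merge and the components stay the same.
    by_cases hv : (g * i).SameCycle (i a) (i b)
    · have h2 := numCycles_mul_swap_of_sameCycle hi' hv
      omega
    · have h2 := numCycles_mul_swap_of_not_sameCycle hv
      have hv' := (sameCycle_mul_swap_iff hi').2 hv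
      rw [← hs] at hv'
      have h3 := mapRel_mk_eq_of_sameCycle_mul hv'
      rw [mapRel_mk_right, mapRel_mk_right] at h3
      rw [numClasses_withPair_of_eq h3] at hc
      omega
  · have h0 : ¬ g.SameCycle a b := fun h' => h (mapRel_mk_eq_of_sameCycle h')
    have h1 := numCycles_mul_swap_of_not_sameCycle h0
    have h2 := numCycles_mul_swap_of_not_sameCycle (g := g * i) (a := i a) (b := i b) fun h' => by
      have := mapRel_mk_eq_of_sameCycle_mul h'
      rw [mapRel_mk_right, mapRel_mk_right] at this
      exact h this
    have h3 := numClasses_withPair_of_ne h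
    rw [numClasses_withPair_of_eq
      (mapRel_mk_eq_of_sameCycle ((sameCycle_mul_swap_iff hab).2 h0))] at hc
    omega

/-- If cutting a planar map along a face splits a vertex, then it disconnects the map. -/
theorem mapRel_mul_swap_mk_ne [Finite E] [DecidableEq E] {g i : Perm E} (hi : ∀ x, i (i x) = x)
    (hne : ∀ x, i x ≠ x) (hN : Nat.card E + 4 * numClasses (mapRel g i) ≤
      2 * numCycles g + 2 * numCycles (g * i))
    {a b : E} (hab : a ≠ b) (h : g.SameCycle a b) (hv : (g * i).SameCycle (i a) (i b)) :
    Quot.mk (mapRel (g * swap a b) i) a ≠ Quot.mk (mapRel (g * swap a b) i) b := by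
  intro h0
  have hs : g * swap a b * i = g * i * swap (i a) (i b) := by
    rw [mul_assoc, swap_mul_involution hi, mul_assoc]
  have hc := numClasses_withPair_mapRel_mul_swap g i a b
  have hi' : i a ≠ i b := fun h => hab (i.injective h)
  have h1 := numCycles_mul_swap_of_sameCycle hab h
  have h2 := numCycles_mul_swap_of_sameCycle hi' hv
  rw [numClasses_withPair_of_eq (mapRel_mk_eq_of_sameCycle h), numClasses_withPair_of_eq h0] at hc
  -- One more face and one more vertex with no new component would violate Euler's inequality.
  have h3 := numCycles_add_numCycles_mul_le (g * swap a b) i hi hne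
  rw [hs] at h3
  omega

end CyclesOfMaps

/-! ### Closing up a bigon -/

section Bigon

open Equiv

variable {E : Type*} [DecidableEq E]

/-- The involution obtained from `i` by pairing `a` with `b` and `i a` with `i b`. -/
def rePair (i : Perm E) (a b : E) : Perm E := i * swap a (i b) * swap (i a) b

variable {i : Perm E} {a b : E}

theorem rePair_apply (hi : ∀ x, i (i x) = x) (hne : ∀ x, i x ≠ x) (hab : a ≠ b) (hiab : i a ≠ b)
    (x : E) : rePair i a b x =
      if x = a then b else if x = b then a else if x = i a then i b else if x = i b then i a
      else i x := by
  have h1 : i b ≠ a := fun h => hiab (by rw [← h, hi])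
  have h2 := i.injective.ne hab
  have h3 := hne a
  have h4 := hne b
  simp only [rePair, Perm.mul_apply, swap_apply_def]
  grind

theorem rePair_rePair (hi : ∀ x, i (i x) = x) (hne : ∀ x, i x ≠ x) (hab : a ≠ b) (hiab : i a ≠ b)
    (x : E) : rePair i a b (rePair i a b x) = x := by
  have h1 : i b ≠ a := fun h => hiab (by rw [← h, hi])
  have h2 := i.injective.ne hab
  have h3 := hne a
  have h4 := hne b
  rw [rePair_apply hi hne hab hiab, rePair_apply hi hne hab hiab]
  grind

theorem rePair_ne (hi : ∀ x, i (i x) = x) (hne : ∀ x, i x ≠ x) (hab : a ≠ b) (hiab : i a ≠ b)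
    (x : E) : rePair i a b x ≠ x := by
  have h2 := i.injective.ne hab
  have h3 := hne a
  have h4 := hne b
  rw [rePair_apply hi hne hab hiab]
  grind

/-- Closing up a bigon of a planar map gives a planar map. -/
theorem genus_rePair [Finite E] {g : Perm E} (hi : ∀ x, i (i x) = x) (hne : ∀ x, i x ≠ x)
    (hab : a ≠ b) (hiab : i a ≠ b) (hga : g a = b) (hgb : g b = a)
    {N : ℕ} (hN : N + 4 * numClasses (mapRel g i) ≤ 2 * numCycles g + 2 * numCycles (g * i)) :
    N + 4 * numClasses (mapRel g (rePair i a b)) ≤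
      2 * numCycles g + 2 * numCycles (g * rePair i a b) := by
  have h1 : i b ≠ a := fun h => hiab (by rw [← h, hi])
  have hs : g * rePair i a b = g * i * swap a (i b) * swap (i a) b := by
    simp only [rePair, mul_assoc]
  -- Both transpositions split a vertex: the old vertices remain on the glued edge, and the detached
  -- edge `{a, b}` gets two ends of its own.
  have c1 : (g * i).SameCycle a (i b) := by
    refine Perm.SameCycle.symm ⟨1, ?_⟩
    rw [zpow_one, Perm.mul_apply, hi, hgb]
  have c2 : (g * i * swap a (i b)).SameCycle (i a) b := by
    refine ⟨1, ?_⟩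
    rw [zpow_one, Perm.mul_apply, swap_apply_of_ne_of_ne (hne a) (i.injective.ne hab),
      Perm.mul_apply, hi, hga]
  have h2 := numCycles_mul_swap_of_sameCycle h1.symm c1
  have h3 := numCycles_mul_swap_of_sameCycle hiab c2
  have h4 := numClasses_le_withPair_add_one (mapRel g (rePair i a b)) a (i a)
  have h5 : numClasses (withPair (mapRel g (rePair i a b)) a (i a)) ≤
      numClasses (mapRel g i) := by
    set s := withPair (mapRel g (rePair i a b)) a (i a) with hsdef
    have e1 : Quot.mk s a = Quot.mk s (i a) := Quot.sound (Or.inr ⟨rfl, rfl⟩)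
    have e2 : Quot.mk s a = Quot.mk s b := Quot.sound (Or.inl (Or.inl hga.symm))
    have e3 : Quot.mk s (i a) = Quot.mk s (i b) := by
      refine Quot.sound (Or.inl (Or.inr ?_))
      rw [rePair_apply hi hne hab hiab, if_neg (hne a), if_neg hiab, if_pos rfl]
    refine numClasses_le_of_forall ?_
    rintro x y (rfl | rfl)
    · exact Quot.sound (Or.inl (Or.inl rfl))
    · by_cases x1 : x = a
      · rw [x1, e1]
      by_cases x2 : x = b
      · rw [x2, ← e2, e1, e3]
      by_cases x3 : x = i a
      · rw [x3, hi, e1]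
      by_cases x4 : x = i b
      · rw [x4, hi, ← e2, e1, e3]
      · refine Quot.sound (Or.inl (Or.inr ?_))
        rw [rePair_apply hi hne hab hiab, if_neg x1, if_neg x2, if_neg x3, if_neg x4]
  rw [hs]
  omega

end Bigon

/-! ### Faces as explicit lists of darts -/

section Traces

open Equiv

variable {E F : Type*}

/-- `Trace g x l y`: the list `l` is the beginning `x, g x, g (g x), …` of the orbit of `x`, and
`y` is the element of the orbit that comes next. -/
def Trace (g : Perm E) : E → List E → E → Prop
  | x, [], y => x = y
  | x, e :: l, y => e = x ∧ Trace g (g x) l y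

theorem trace_append {g : Perm E} {l m : List E} {x z : E} :
    Trace g x (l ++ m) z ↔ ∃ y, Trace g x l y ∧ Trace g y m z := by
  induction l generalizing x with
  | nil => simp [Trace]
  | cons e l ih => simp [Trace, ih, and_assoc]

theorem trace_concat {g : Perm E} {l : List E} {a x y : E} :
    Trace g x (l ++ [a]) y ↔ Trace g x l a ∧ g a = y := by
  rw [trace_append]
  constructor
  · rintro ⟨z, h, rfl, h'⟩
    exact ⟨h, h'⟩
  · rintro ⟨h, h'⟩
    exact ⟨a, h, rfl, h'⟩

theorem Trace.congr {g h : Perm E} {l : List E} (hl : ∀ e ∈ l, h e = g e) {x y : E}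
    (ht : Trace g x l y) : Trace h x l y := by
  induction l generalizing x with
  | nil => exact ht
  | cons e l ih =>
    obtain ⟨rfl, ht⟩ := ht
    refine ⟨rfl, ?_⟩
    rw [hl e (by simp)]
    exact ih (fun e' he' => hl e' (by simp [he'])) ht

theorem Trace.map {g : Perm E} {h : Perm F} (f : E → F) {l : List E}
    (hl : ∀ e ∈ l, h (f e) = f (g e)) {x y : E} (ht : Trace g x l y) :
    Trace h (f x) (l.map f) (f y) := by
  induction l generalizing x with
  | nil => exact congrArg f ht
  | cons e l ih =>
    obtain ⟨rfl, ht⟩ := ht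
    refine ⟨rfl, ?_⟩
    rw [hl e (by simp)]
    exact ih (fun e' he' => hl e' (by simp [he'])) ht

theorem Trace.eq_iterate {g : Perm E} {l : List E} {x y : E} (ht : Trace g x l y) :
    l = List.iterate g x l.length ∧ g^[l.length] x = y := by
  induction l generalizing x with
  | nil => exact ⟨rfl, ht⟩
  | cons e l ih =>
    obtain ⟨rfl, ht⟩ := ht
    obtain ⟨h1, h2⟩ := ih ht
    exact ⟨by simp only [List.length_cons, List.iterate]; rw [← h1], h2⟩

/-- `L` lists the cycle of `x` under `g`, starting with `x`. -/
structure IsFace (g : Perm E) (x : E) (L : List E) : Prop where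
  ne_nil : L ≠ []
  nodup : L.Nodup
  trace : Trace g x L x

theorem IsFace.length_pos {g : Perm E} {x : E} {L : List E} (h : IsFace g x L) : 0 < L.length :=
  List.length_pos_iff.2 h.ne_nil

theorem IsFace.mem_iff {g : Perm E} {x : E} {L : List E} (h : IsFace g x L) {y : E} :
    y ∈ L ↔ g.SameCycle x y := by
  obtain ⟨h1, h2⟩ := h.trace.eq_iterate
  rw [h1, List.mem_iterate]
  constructor
  · rintro ⟨k, -, rfl⟩
    exact ⟨k, by rw [zpow_natCast, Perm.iterate_eq_pow]⟩
  · intro hxy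
    have hp : Function.IsPeriodicPt g L.length x := h2
    obtain ⟨j, rfl⟩ := hxy
    have hL : (0 : ℤ) < L.length := by exact_mod_cast h.length_pos
    refine ⟨(j % L.length).toNat, ?_, ?_⟩
    · have := Int.emod_lt_of_pos j hL
      omega
    · rw [Perm.iterate_eq_pow, ← zpow_natCast, Int.toNat_of_nonneg (Int.emod_nonneg _ hL.ne')]
      conv_lhs => rw [← Int.emod_add_mul_ediv j L.length, zpow_add, zpow_mul, Perm.mul_apply]
      congr 1
      have hfix : Function.IsFixedPt (g ^ (L.length : ℤ)) x := by
        rw [Function.IsFixedPt, zpow_natCast, ← Perm.iterate_eq_pow]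
        exact h2
      exact hfix.perm_zpow _

/-- Links face lists with the description by iterates and minimal periods in `DiskDiagram`. -/
theorem IsFace.minimalPeriod_eq {g : Perm E} {x : E} {L : List E} (h : IsFace g x L) :
    Function.minimalPeriod g x = L.length := by
  obtain ⟨h1, h2⟩ := h.trace.eq_iterate
  have hp : Function.IsPeriodicPt g L.length x := h2
  refine le_antisymm (hp.minimalPeriod_le h.length_pos) ?_
  by_contra! hlt
  have hnd := h.nodup
  rw [h1] at hnd
  have hpos := hp.minimalPeriod_pos h.length_pos
  have := (List.nodup_iff_injective_getElem.1 hnd)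
    (a₁ := ⟨Function.minimalPeriod g x, by simpa using hlt⟩)
    (a₂ := ⟨0, by simpa using h.length_pos⟩)
    (by simp)
  simp only [Fin.mk.injEq] at this
  omega

theorem IsFace.iterate_eq {g : Perm E} {x : E} {L : List E} (h : IsFace g x L) :
    List.iterate g x (Function.minimalPeriod g x) = L := by
  rw [h.minimalPeriod_eq]
  exact h.trace.eq_iterate.1.symm

theorem IsFace.mem_of_sameCycle {g : Perm E} {x y z : E} {L : List E} (h : IsFace g x L)
    (hy : y ∈ L) (hyz : g.SameCycle y z) : z ∈ L :=
  h.mem_iff.2 ((h.mem_iff.1 hy).trans hyz)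

theorem IsFace.congr {g h : Perm E} {x : E} {L : List E} (hL : IsFace g x L)
    (hl : ∀ e ∈ L, h e = g e) : IsFace h x L :=
  ⟨hL.ne_nil, hL.nodup, hL.trace.congr hl⟩

theorem IsFace.map {g : Perm E} {h : Perm F} {x : E} {L : List E} (hL : IsFace g x L) (f : E → F)
    (hf : Function.Injective f) (hl : ∀ e ∈ L, h (f e) = f (g e)) : IsFace h (f x) (L.map f) :=
  ⟨by simpa using hL.ne_nil, hL.nodup.map hf, hL.trace.map f hl⟩

theorem IsFace.head_mem {g : Perm E} {x : E} {L : List E} (h : IsFace g x L) : x ∈ L :=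
  h.mem_iff.2 (Perm.SameCycle.refl _ _)

/-- Cutting the face `A ++ B ++ C` at the ends of `A` and `B`. -/
theorem IsFace.cut [DecidableEq E] {g : Perm E} {x a b : E} {A B C : List E}
    (h : IsFace g x ((A ++ [a]) ++ (B ++ [b]) ++ C)) :
    IsFace (g * swap a b) x ((A ++ [a]) ++ C) ∧ IsFace (g * swap a b) (g a) (B ++ [b]) := by
  obtain ⟨-, hnd, ht⟩ := h
  obtain ⟨c, ht, hC⟩ := trace_append.1 ht
  obtain ⟨b', hA', hB'⟩ := trace_append.1 ht
  obtain ⟨hA, rfl⟩ := trace_concat.1 hA'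
  obtain ⟨hB, rfl⟩ := trace_concat.1 hB'
  clear hA' hB'
  have ha : (g * swap a b) a = g b := by simp
  have hb : (g * swap a b) b = g a := by simp
  have hoff : ∀ e, e ≠ a → e ≠ b → (g * swap a b) e = g e := fun e h1 h2 => by
    rw [Perm.mul_apply, swap_apply_of_ne_of_ne h1 h2]
  simp only [List.nodup_append, List.mem_append, List.mem_singleton] at hnd
  obtain ⟨⟨⟨hA1, -, hA2⟩, ⟨hB1, -, hB2⟩, hAB⟩, hC1, hABC⟩ := hnd
  refine ⟨⟨by simp, ?_, ?_⟩, by simp, ?_, ?_⟩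
  · simp only [List.nodup_append, List.mem_append, List.mem_singleton]
    exact ⟨⟨hA1, by simp, hA2⟩, hC1, fun u hu w hw => hABC u (Or.inl hu) w hw⟩
  · refine trace_append.2 ⟨g b, trace_concat.2 ⟨hA.congr fun e he => ?_, ha⟩,
      hC.congr fun e he => ?_⟩
    · exact hoff e (hA2 e he a rfl) (hAB e (Or.inl he) b (Or.inr rfl))
    · exact hoff e (hABC a (Or.inl (Or.inr rfl)) e he).symm
        (hABC b (Or.inr (Or.inr rfl)) e he).symm
  · simp only [List.nodup_append, List.mem_singleton]
    exact ⟨hB1, by simp, hB2⟩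
  · refine trace_concat.2 ⟨hB.congr fun e he => ?_, hb⟩
    exact hoff e (hAB a (Or.inr rfl) e (Or.inl he)).symm (hB2 e he b rfl)

/-- The converse operation for faces of two maps. -/
theorem IsFace.join [DecidableEq (E ⊕ F)] {g : Perm E} {h : Perm F} {x a : E} {y b : F}
    {A C : List E} {B : List F} (hA : IsFace g x ((A ++ [a]) ++ C)) (hB : IsFace h y (B ++ [b])) :
    IsFace (Perm.sumCongr g h * swap (Sum.inl a) (Sum.inr b)) (Sum.inl x)
      (((A ++ [a]).map Sum.inl ++ (B ++ [b]).map Sum.inr) ++ C.map Sum.inl) := by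
  obtain ⟨-, hnd, ht⟩ := hA
  obtain ⟨-, hnd', ht'⟩ := hB
  obtain ⟨c, hA', hC⟩ := trace_append.1 ht
  obtain ⟨hA, rfl⟩ := trace_concat.1 hA'
  clear hA'
  obtain ⟨hB, hby⟩ := trace_concat.1 ht'
  set G := Perm.sumCongr g h * swap (Sum.inl a) (Sum.inr b) with hG
  have ha : G (Sum.inl a) = Sum.inr y := by simp [hG, hby]
  have hb : G (Sum.inr b) = Sum.inl (g a) := by simp [hG]
  have hoff : ∀ e, e ≠ a → G (Sum.inl e) = Sum.inl (g e) := fun e h1 => by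
    rw [hG, Perm.mul_apply, swap_apply_of_ne_of_ne (by simpa using h1) (by simp)]
    rfl
  have hoff' : ∀ e, e ≠ b → G (Sum.inr e) = Sum.inr (h e) := fun e h1 => by
    rw [hG, Perm.mul_apply, swap_apply_of_ne_of_ne (by simp) (by simpa using h1)]
    rfl
  have hndL : ((A ++ [a]).map Sum.inl ++ (B ++ [b]).map Sum.inr ++ C.map Sum.inl :
      List (E ⊕ F)).Nodup := by
    rw [List.nodup_append'] at hnd ⊢
    obtain ⟨h1, h2, h3⟩ := hnd
    refine ⟨?_, h2.map Sum.inl_injective, ?_⟩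
    · rw [List.nodup_append']
      refine ⟨h1.map Sum.inl_injective, hnd'.map Sum.inr_injective, ?_⟩
      intro z hz hz'
      obtain ⟨u, -, rfl⟩ := List.mem_map.1 hz
      obtain ⟨w, -, hw⟩ := List.mem_map.1 hz'
      cases hw
    · intro z hz hz'
      obtain ⟨u, hu, rfl⟩ := List.mem_map.1 hz'
      rcases List.mem_append.1 hz with hz | hz
      · obtain ⟨w, hw, hwu⟩ := List.mem_map.1 hz
        exact h3 hw (Sum.inl_injective hwu ▸ hu)
      · obtain ⟨w, -, hw⟩ := List.mem_map.1 hz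
        cases hw
  simp only [List.nodup_append, List.mem_append, List.mem_singleton] at hnd hnd'
  obtain ⟨⟨hA1, -, hA2⟩, hC1, hAC⟩ := hnd
  obtain ⟨hB1, -, hB2⟩ := hnd'
  refine ⟨by simp, hndL, trace_append.2 ⟨Sum.inl (g a), trace_append.2 ⟨Sum.inr y, ?_, ?_⟩, ?_⟩⟩
  · rw [List.map_append]
    exact trace_concat.2 ⟨hA.map Sum.inl fun e he => hoff e (hA2 e he a rfl), ha⟩
  · rw [List.map_append]
    exact trace_concat.2 ⟨hB.map Sum.inr fun e he => hoff' e (hB2 e he b rfl), hb⟩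
  · exact hC.map Sum.inl fun e he => hoff e (hAC a (Or.inr rfl) e he).symm

end Traces

/-! ### Distances from the base dart -/

section Reach

open Equiv

variable {E F : Type*}

/-- `Reach g i o k e`: in the map with faces the cycles of `g` and edges the cycles of `i`, the
origins of `o` and of `e` are joined by a path of length at most `k`. -/
inductive Reach (g i : Perm E) (o : E) : ℕ → E → Prop
  | base (k : ℕ) : Reach g i o k o
  | rot {k : ℕ} {e : E} : Reach g i o k e → Reach g i o k (g (i e))
  | step {k : ℕ} {e : E} : Reach g i o k e → Reach g i o (k + 1) (i e)

theorem Reach.mono {g i : Perm E} {o e : E} {k l : ℕ} (h : Reach g i o k e) (hkl : k ≤ l) :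
    Reach g i o l e := by
  induction h generalizing l with
  | base k => exact Reach.base l
  | rot _ ih => exact (ih hkl).rot
  | step _ ih =>
    obtain ⟨l, rfl⟩ : ∃ l', l = l' + 1 := ⟨l - 1, by omega⟩
    exact (ih (by omega)).step

theorem Reach.next {g i : Perm E} (hi : ∀ x, i (i x) = x) {o e : E} {k : ℕ}
    (h : Reach g i o k e) : Reach g i o (k + 1) (g e) := by
  have := h.step.rot
  rwa [hi] at this

theorem Reach.trace {g i : Perm E} (hi : ∀ x, i (i x) = x) {o : E} {l : List E} {x y : E} {k : ℕ}
    (hl : Trace g x l y) (h : Reach g i o k x) : Reach g i o (k + l.length) y := by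
  induction l generalizing x k with
  | nil => exact hl ▸ h
  | cons e l ih =>
    rw [List.length_cons, add_comm l.length, ← add_assoc]
    exact ih hl.2 (h.next hi)

theorem Reach.sameCycle [Finite E] {g i : Perm E} {o x y : E} {k : ℕ} (h : Reach g i o k x)
    (hxy : (g * i).SameCycle x y) : Reach g i o k y := by
  obtain ⟨j, rfl⟩ := hxy.exists_nat_pow_eq
  clear hxy
  induction j with
  | zero => exact h
  | succ j ih =>
    rw [pow_succ', Perm.mul_apply]
    exact ih.rot

theorem reach_iff [Finite E] {g i : Perm E} (hi : ∀ x, i (i x) = x) {o e : E} :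
    (∃ k, Reach g i o k e) ↔ Quot.mk (mapRel g i) o = Quot.mk (mapRel g i) e := by
  constructor
  · rintro ⟨k, h⟩
    induction h with
    | base => rfl
    | rot _ ih => rw [mapRel_mk_left, mapRel_mk_right, ih]
    | step _ ih => rw [mapRel_mk_right, ih]
  · intro h
    have hg : ∀ x, (∃ k, Reach g i o k (g x)) ↔ ∃ k, Reach g i o k x := by
      intro x
      constructor
      · rintro ⟨k, hk⟩
        have : Reach g i o k (i x) := hk.sameCycle
          (Perm.SameCycle.symm ⟨1, by rw [zpow_one, Perm.mul_apply, hi]⟩)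
        exact ⟨k + 1, hi x ▸ this.step⟩
      · rintro ⟨k, hk⟩
        exact ⟨k + 1, hk.next hi⟩
    have hi' : ∀ x, (∃ k, Reach g i o k (i x)) ↔ ∃ k, Reach g i o k x := by
      refine fun x => ⟨?_, ?_⟩
      · rintro ⟨k, hk⟩
        exact ⟨k + 1, hi x ▸ hk.step⟩
      · rintro ⟨k, hk⟩
        exact ⟨k + 1, hk.step⟩
    have := congrArg (Quot.lift (fun x => ∃ k, Reach g i o k x) (by
      rintro x y (rfl | rfl)
      · exact propext (hg x).symm
      · exact propext (hi' x).symm)) h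
    exact this.mp ⟨0, Reach.base 0⟩

/-- Cutting a planar map along a face does not increase distances in the component of `o`. -/
theorem reach_mul_swap [Finite E] [DecidableEq E] {g i : Perm E} (hi : ∀ x, i (i x) = x)
    (hne : ∀ x, i x ≠ x) (hN : Nat.card E + 4 * numClasses (mapRel g i) ≤
      2 * numCycles g + 2 * numCycles (g * i))
    {a b o : E} (hab : a ≠ b) (h : g.SameCycle a b) (ho : (g * swap a b).SameCycle o a) {m : ℕ}
    (hm : ∀ k e, Reach g i o k e → Reach g i o m e) (k : ℕ) (e : E)
    (he : Reach (g * swap a b) i o k e) : Reach (g * swap a b) i o m e := by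
  have hoa : Quot.mk (mapRel (g * swap a b) i) o = Quot.mk _ a := mapRel_mk_eq_of_sameCycle ho
  have hold : ∀ x y, Quot.mk (mapRel (g * swap a b) i) x = Quot.mk _ y →
      Quot.mk (mapRel g i) x = Quot.mk _ y := by
    intro x y hxy
    refine congrArg (Quot.lift (Quot.mk (mapRel g i)) ?_) hxy
    have hab' := mapRel_mk_eq_of_sameCycle (i := i) h
    rintro x y (rfl | rfl)
    · rw [Perm.mul_apply, mapRel_mk_left, swap_apply_def]
      split_ifs with h1 h2
      · rw [h1, hab']
      · rw [h2, hab']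
      · rfl
    · rw [mapRel_mk_right]
  have hea := (reach_iff hi).1 ⟨k, he⟩
  obtain ⟨k', hk'⟩ := (reach_iff hi).2 (hold _ _ hea)
  have hold_e := hm _ _ hk'
  rw [hoa] at hea
  clear hk' he
  have hs : g * swap a b * i = g * i * swap (i a) (i b) := by
    rw [mul_assoc, swap_mul_involution hi, mul_assoc]
  have hi' : i a ≠ i b := fun h => hab (i.injective h)
  have hga : (g * swap a b) (i (i a)) = g b := by rw [hi]; simp
  have hgb : (g * swap a b) (i (i b)) = g a := by rw [hi]; simp
  have hoff : ∀ x, x ≠ i a → x ≠ i b → (g * swap a b) (i x) = g (i x) := fun x h1 h2 => by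
    rw [Perm.mul_apply, swap_apply_of_ne_of_ne]
    · exact fun h => h1 (by rw [← h, hi])
    · exact fun h => h2 (by rw [← h, hi])
  by_cases hv : (g * i).SameCycle (i a) (i b)
  · have hsep := mapRel_mul_swap_mk_ne hi hne hN hab h hv
    suffices H : ∀ k e, Reach g i o k e →
        (Quot.mk (mapRel (g * swap a b) i) a = Quot.mk _ e → Reach (g * swap a b) i o k e) ∧
        (Quot.mk (mapRel (g * swap a b) i) a ≠ Quot.mk _ e → Reach (g * swap a b) i o k (i a)) from
      (H _ _ hold_e).1 hea
    intro k e he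
    induction he with
    | base k => exact ⟨fun _ => Reach.base k, fun h => absurd hoa.symm h⟩
    | @rot k e _ ih =>
      by_cases h1 : e = i a
      · subst h1
        have hR := ih.1 (mapRel_mk_right _ _ _).symm
        refine ⟨fun h => absurd ?_ hsep, fun _ => hR⟩
        rw [h, hi, ← hgb, mapRel_mk_left, mapRel_mk_right, mapRel_mk_right]
      by_cases h2 : e = i b
      · subst h2
        have hR := ih.2 (by rwa [mapRel_mk_right])
        refine ⟨fun _ => ?_, fun _ => hR⟩
        have := hR.rot
        rw [hga] at this
        rwa [hi]
      · rw [← hoff e h1 h2, mapRel_mk_left, mapRel_mk_right]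
        exact ⟨fun h => (ih.1 h).rot, ih.2⟩
    | step _ ih =>
      rw [mapRel_mk_right]
      exact ⟨fun h => (ih.1 h).step, fun h => (ih.2 h).mono (Nat.le_succ _)⟩
  -- Here two vertices merge. Old paths survive: a rotation across the cut is replaced by a move
  -- within the merged vertex.
  · have hv' := (sameCycle_mul_swap_iff hi').2 hv
    rw [← hs] at hv'
    clear hea hm
    induction hold_e with
    | base k => exact Reach.base k
    | @rot k e _ ih =>
      by_cases h1 : e = i a
      · subst h1
        have := (ih.sameCycle hv').rot
        rw [hgb] at this
        rwa [hi]
      by_cases h2 : e = i b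
      · subst h2
        have := (ih.sameCycle hv'.symm).rot
        rw [hga] at this
        rwa [hi]
      · rw [← hoff e h1 h2]
        exact ih.rot
    | step _ ih => exact ih.step

/-- Closing up a bigon of a planar map does not increase distances in the component of `o`. -/
theorem reach_rePair [Finite E] [DecidableEq E] {g i : Perm E} (hi : ∀ x, i (i x) = x)
    (hne : ∀ x, i x ≠ x) {a b o : E}
    (hab : a ≠ b) (hiab : i a ≠ b) (hga : g a = b) (hgb : g b = a) (hoa : o ≠ a) (hob : o ≠ b)
    {m : ℕ} (hm : ∀ k e, Reach g i o k e → Reach g i o m e) (k : ℕ) (e : E)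
    (he : Reach g (rePair i a b) o k e) : Reach g (rePair i a b) o m e := by
  have hJ := rePair_apply hi hne hab hiab
  have hJJ := rePair_rePair hi hne hab hiab
  have h1 : i b ≠ a := fun h => hiab (by rw [← h, hi])
  have h2 := i.injective.ne hab
  -- The detached edge `{a, b}` cannot be reached from `o`.
  have hea : e ≠ a ∧ e ≠ b := by
    clear hm
    induction he with
    | base => exact ⟨hoa, hob⟩
    | @rot k e _ ih =>
      have hcl : rePair i a b e ≠ a ∧ rePair i a b e ≠ b :=
        ⟨fun h => ih.2 (by rw [← hJJ e, h, hJ]; simp),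
          fun h => ih.1 (by rw [← hJJ e, h, hJ]; simp)⟩
      exact ⟨fun h => hcl.2 (g.injective (h.trans hgb.symm)),
        fun h => hcl.1 (g.injective (h.trans hga.symm))⟩
    | @step k e _ ih =>
      exact ⟨fun h => ih.2 (by rw [← hJJ e, h, hJ]; simp),
        fun h => ih.1 (by rw [← hJJ e, h, hJ]; simp)⟩
  have hold : Quot.mk (mapRel g i) o = Quot.mk _ e := by
    have := (reach_iff hJJ).1 ⟨k, he⟩
    refine congrArg (Quot.lift (Quot.mk (mapRel g i)) ?_) this
    have hab' : Quot.mk (mapRel g i) a = Quot.mk _ b := by rw [← hga, mapRel_mk_left]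
    rintro x y (rfl | rfl)
    · rw [mapRel_mk_left]
    · rw [hJ]
      split_ifs with h1 h2 h3 h4
      · rw [h1, hab']
      · rw [h2, hab']
      · rw [h3, mapRel_mk_right, mapRel_mk_right, hab']
      · rw [h4, mapRel_mk_right, mapRel_mk_right, hab']
      · rw [mapRel_mk_right]
  obtain ⟨k', hk'⟩ := (reach_iff hi).2 hold
  have H := hm _ _ hk'
  -- Darts that get detached are replaced by darts with the same origin in the old map: `a` and `i
  -- b` start at one vertex, as do `b` and `i a`.
  let r : E → E := fun x => if x = a then i b else if x = b then i a else x
  have hr : ∀ x, x ≠ a → x ≠ b → r x = x := fun x h1 h2 => by simp [r, h1, h2]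
  have hra : r a = i b := by simp [r]
  have hrb : r b = i a := by simp [r, hab.symm]
  suffices ∀ k e, Reach g i o k e → Reach g (rePair i a b) o k (r e) by
    have := this _ _ H
    rwa [hr e hea.1 hea.2] at this
  have Ja : rePair i a b (i a) = i b := by
    rw [hJ, if_neg (hne a), if_neg hiab, if_pos rfl]
  have Jb : rePair i a b (i b) = i a := by
    rw [hJ, if_neg h1, if_neg (hne b), if_neg h2.symm, if_pos rfl]
  have hgr : ∀ x, x ≠ a → x ≠ b → r (g x) = g x := fun x h3 h4 => hr _
    (fun h => h4 (g.injective (h.trans hgb.symm))) (fun h => h3 (g.injective (h.trans hga.symm)))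
  intro k e he
  clear hm H hk' hold
  induction he with
  | base k => rw [hr o hoa hob]; exact Reach.base k
  | @rot k e _ ih =>
    by_cases x1 : e = a
    · subst x1
      rw [hra] at ih
      rw [hgr _ (hne e) hiab, ← Jb]
      exact ih.rot
    by_cases x2 : e = b
    · subst x2
      rw [hrb] at ih
      rw [hgr _ h1 (hne e), ← Ja]
      exact ih.rot
    rw [hr e x1 x2] at ih
    by_cases x3 : e = i a
    · subst x3
      rwa [hi, hga, hrb]
    by_cases x4 : e = i b
    · subst x4
      rwa [hi, hgb, hra]
    have y1 : i e ≠ a := fun h => x3 (by rw [← h, hi])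
    have y2 : i e ≠ b := fun h => x4 (by rw [← h, hi])
    have := ih.rot
    rwa [hJ, if_neg x1, if_neg x2, if_neg x3, if_neg x4, ← hgr _ y1 y2] at this
  | @step k e _ ih =>
    by_cases x1 : e = a
    · subst x1
      rw [hra] at ih
      rw [hr _ (hne e) hiab, ← Jb]
      exact ih.step
    by_cases x2 : e = b
    · subst x2
      rw [hrb] at ih
      rw [hr _ h1 (hne e), ← Ja]
      exact ih.step
    rw [hr e x1 x2] at ih
    by_cases x3 : e = i a
    · subst x3
      have := ih.step
      rw [Ja, ← hra] at this
      rwa [hi]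
    by_cases x4 : e = i b
    · subst x4
      have := ih.step
      rw [Jb, ← hrb] at this
      rwa [hi]
    have y1 : i e ≠ a := fun h => x3 (by rw [← h, hi])
    have y2 : i e ≠ b := fun h => x4 (by rw [← h, hi])
    have := ih.step
    rwa [hJ, if_neg x1, if_neg x2, if_neg x3, if_neg x4, ← hr _ y1 y2] at this

end Reach
end ShortcutGraph

/-! ### Planar maps labelled by a 2-complex -/

namespace ShortcutGraph

open Equiv

/-- A combinatorial map to `X` all of whose components are spheres (the genus of a combinatorial map
is nonnegative, so that the inequality `genus` says that it vanishes). -/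
structure PlanarMap (X : TwoComplex.{u}) where
  E : Type
  finite : Finite E
  next : Perm E
  inv : Perm E
  inv_inv : ∀ e, inv (inv e) = e
  inv_ne : ∀ e, inv e ≠ e
  lab : E → X.E
  lab_inv : ∀ e, lab (inv e) = X.inv (lab e)
  src_lab_next : ∀ e, X.src (lab (next e)) = X.tgt (lab e)
  genus : Nat.card E + 4 * numClasses (mapRel next inv) ≤
    2 * numCycles next + 2 * numCycles (next * inv)

/-- The edge path `l` is the boundary path of a 2-cell or its reverse. -/
def IsCellLabel (X : TwoComplex.{u}) (l : List X.E) : Prop :=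
  ∃ c : X.Cell, l = X.bdry c ∨ l = X.reversePath (X.bdry c)

namespace PlanarMap

variable {X : TwoComplex.{u}}

/-- The face of `e` is mapped to a 2-cell, or it is a bigon which forms a component by itself. -/
def GoodFace (D : PlanarMap X) (e : D.E) : Prop :=
  (D.inv e = D.next e ∧ D.next (D.next e) = e) ∨
    ∃ x L, e ∈ L ∧ IsFace D.next x L ∧ IsCellLabel X (L.map D.lab)

/-- The component of `o` is a diagram of radius at most `m` with outer face `L`. -/
structure Fills (D : PlanarMap X) (o : D.E) (L : List D.E) (m : ℕ) : Prop where
  face : IsFace D.next o L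
  good : ∀ e, e ∉ L → D.GoodFace e
  radius : ∀ k e, Reach D.next D.inv o k e → Reach D.next D.inv o m e

open Classical in
/-- Close up a bigon. -/
noncomputable def closeBigon (D : PlanarMap X) (a b : D.E) (hab : a ≠ b) (hiab : D.inv a ≠ b)
    (hga : D.next a = b) (hgb : D.next b = a) (hlab : D.lab b = X.inv (D.lab a)) :
    PlanarMap X where
  E := D.E
  finite := D.finite
  next := D.next
  inv := rePair D.inv a b
  inv_inv := rePair_rePair D.inv_inv D.inv_ne hab hiab
  inv_ne := rePair_ne D.inv_inv D.inv_ne hab hiab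
  lab := D.lab
  lab_inv e := by
    rw [rePair_apply D.inv_inv D.inv_ne hab hiab]
    split_ifs with h1 h2 h3 h4
    · rw [h1, hlab]
    · rw [h2, hlab, X.inv_inv]
    · rw [h3, D.lab_inv, D.lab_inv, hlab]
    · rw [h4, D.lab_inv, D.lab_inv, hlab, X.inv_inv]
    · exact D.lab_inv e
  src_lab_next := D.src_lab_next
  genus := by
    have := D.finite
    exact genus_rePair D.inv_inv D.inv_ne hab hiab hga hgb D.genus

/-- The disjoint union of two maps. -/
noncomputable def sum (D D' : PlanarMap X) : PlanarMap X where
  E := D.E ⊕ D'.E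
  finite := by
    have := D.finite
    have := D'.finite
    infer_instance
  next := Perm.sumCongr D.next D'.next
  inv := Perm.sumCongr D.inv D'.inv
  inv_inv := by rintro (e | e) <;> simp [D.inv_inv, D'.inv_inv]
  inv_ne := by rintro (e | e) <;> simp [D.inv_ne, D'.inv_ne]
  lab := Sum.elim D.lab D'.lab
  lab_inv := by rintro (e | e) <;> simp [D.lab_inv, D'.lab_inv]
  src_lab_next := by rintro (e | e) <;> simp [D.src_lab_next, D'.src_lab_next]
  genus := by
    have := D.finite
    have := D'.finite
    have h1 := D.genus
    have h2 := D'.genus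
    rw [Nat.card_sum, numClasses_mapRel_sumCongr, Perm.sumCongr_mul, numCycles_sumCongr,
      numCycles_sumCongr]
    omega

/-- The map with a single edge. -/
noncomputable def segment (x : X.E) : PlanarMap X where
  E := Bool
  finite := inferInstance
  next := boolNot
  inv := boolNot
  inv_inv := by simp
  inv_ne := by simp
  lab b := if b then x else X.inv x
  lab_inv := by rintro (_ | _) <;> simp [X.inv_inv]
  src_lab_next := by rintro (_ | _) <;> simp [OneComplex.tgt, X.inv_inv]
  genus := by
    have h1 : boolNot * boolNot = (1 : Perm Bool) := by ext b; simp
    have h2 : numCycles (1 : Perm Bool) = 2 := by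
      rw [← Nat.card_eq_two_iff.2 ⟨false, true, by simp, by ext b; cases b <;> simp⟩]
      refine Nat.card_congr (Equiv.symm ⟨Quot.mk _, Quot.lift id fun x y h => h.symm, ?_, ?_⟩)
      · intro b; rfl
      · rintro ⟨b⟩; rfl
    have h3 : 0 < numCycles boolNot := Nat.card_pos_iff.2 ⟨⟨Quot.mk _ true⟩, inferInstance⟩
    have h4 : numClasses (mapRel boolNot boolNot) ≤ 1 := by
      refine Finite.card_le_one_iff_subsingleton.2 ⟨?_⟩
      have : ∀ b, Quot.mk (mapRel boolNot boolNot) b = Quot.mk _ true := by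
        rintro (_ | _)
        · exact mapRel_mk_left boolNot boolNot true
        · rfl
      rintro ⟨b⟩ ⟨c⟩
      rw [this b, this c]
    rw [h1, h2, Nat.card_eq_fintype_card, Fintype.card_bool]
    omega

end PlanarMap

/-- There is a disk diagram over `X` with base point at `v`, boundary path `w` and radius at most
`m`. -/
def HasDiagram (X : TwoComplex.{u}) (v : X.V) (w : List X.E) (m : ℕ) : Prop :=
  ∃ (D : PlanarMap X) (o : D.E) (L : List D.E), D.Fills o L m ∧ L.map D.lab = w ∧
    X.src (D.lab o) = v

/-! ### Joining, cutting and folding diagrams -/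

section Operations

variable {X : TwoComplex.{u}}

theorem HasDiagram.mono {v : X.V} {w : List X.E} {m m' : ℕ} (h : HasDiagram X v w m)
    (hm : m ≤ m') : HasDiagram X v w m' := by
  obtain ⟨D, o, L, hL, hw, hv⟩ := h
  exact ⟨D, o, L, ⟨hL.face, hL.good, fun k e h => (hL.radius k e h).mono hm⟩, hw, hv⟩

theorem isPath_append {Y : OneComplex.{u}} {l m : List Y.E} {x z : Y.V} :
    Y.IsPath x (l ++ m) z ↔ ∃ y, Y.IsPath x l y ∧ Y.IsPath y m z := by
  induction l generalizing x with
  | nil => simp [OneComplex.IsPath]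
  | cons e l ih => simp [OneComplex.IsPath, ih, and_assoc]

theorem isPath_concat {Y : OneComplex.{u}} {l : List Y.E} {e : Y.E} {x z : Y.V} :
    Y.IsPath x (l ++ [e]) z ↔ Y.IsPath x l (Y.src e) ∧ Y.tgt e = z := by
  rw [isPath_append]
  constructor
  · rintro ⟨y, h, rfl, h'⟩
    exact ⟨h, h'⟩
  · rintro ⟨h, h'⟩
    exact ⟨_, h, rfl, h'⟩

theorem hasDiagram_segment (x : X.E) : HasDiagram X (X.src x) [x, X.inv x] 1 := by
  have hface : IsFace boolNot true [true, false] := ⟨by simp, by simp, rfl, rfl, rfl⟩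
  have hmem : ∀ b : Bool, b ∈ [true, false] := by simp
  have hrad : ∀ b : Bool, Reach boolNot boolNot true 1 b := by
    rintro (_ | _)
    · exact Reach.step (Reach.base 0)
    · exact Reach.base 1
  exact ⟨PlanarMap.segment x, true, [true, false],
    ⟨hface, fun e he => absurd (hmem e) he, fun _ e _ => hrad e⟩, rfl, rfl⟩

/-- The disjoint union becomes connected by transposing the last dart of `p` with the last dart of
the second boundary. The number `k` bounds the distance from the base point to the point of
attachment; if `q = []`, that is the base point itself and any `k` will do. -/
theorem HasDiagram.join {v y : X.V} {p q w : List X.E} {m m' k : ℕ}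
    (h : HasDiagram X v (p ++ q) m) (hp : p ≠ []) (hvy : X.IsPath v p y)
    (h' : HasDiagram X y w m') (hk : q = [] ∨ p.length ≤ k) :
    HasDiagram X v (p ++ w ++ q) (max m (k + m')) := by
  classical
  obtain ⟨D, o, L, hL, hw, hv⟩ := h
  obtain ⟨D', o', L', hL', rfl, hv'⟩ := h'
  obtain ⟨A, C, rfl, rfl, rfl⟩ := List.map_eq_append_iff.1 hw
  have hA : A ≠ [] := fun h => hp (by simp [h])
  obtain ⟨A, a, rfl⟩ := List.eq_nil_or_concat' A |>.resolve_left hA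
  obtain ⟨B, b, rfl⟩ := List.eq_nil_or_concat' L' |>.resolve_left hL'.face.ne_nil
  have := D.finite
  have := D'.finite
  have hb : D'.next b = o' := (trace_concat.1 hL'.face.trace).2
  have hlab : X.tgt (D.lab a) = X.tgt (D'.lab b) := by
    rw [← D'.src_lab_next, hb, hv']
    rw [List.map_append] at hvy
    exact (isPath_concat.1 hvy).2
  have hsep := mapRel_sumCongr_mk_ne D.next D.inv D'.next D'.inv a b
  have hne : (Sum.inl a : D.E ⊕ D'.E) ≠ Sum.inr b := by simp
  have hface := hL.face.join hL'.face
  set G : Perm (D.E ⊕ D'.E) :=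
    Perm.sumCongr D.next D'.next * swap (Sum.inl a) (Sum.inr b) with hG
  set I : Perm (D.E ⊕ D'.E) := Perm.sumCongr D.inv D'.inv with hI
  have hII : ∀ x, I (I x) = x := (D.sum D').inv_inv
  have hsrc : ∀ e, X.src (Sum.elim D.lab D'.lab (G e)) = X.tgt (Sum.elim D.lab D'.lab e) := by
    intro e
    have h1 : ∀ e, X.src (Sum.elim D.lab D'.lab (Perm.sumCongr D.next D'.next e)) =
      X.tgt (Sum.elim D.lab D'.lab e) := (D.sum D').src_lab_next
    rw [hG, Perm.mul_apply, h1, swap_apply_def]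
    split_ifs with h1 h2
    · rw [h1]
      exact hlab.symm
    · rw [h2]
      exact hlab
    · rfl
  have ha : G (Sum.inl a) = Sum.inr o' := by simp [hG, hb]
  have hbG : G (Sum.inr b) = Sum.inl (D.next a) := by simp [hG]
  have hoff : ∀ e, e ≠ a → G (Sum.inl e) = Sum.inl (D.next e) := fun e h1 => by
    rw [hG, Perm.mul_apply, swap_apply_of_ne_of_ne (by simpa using h1) (by simp)]
    rfl
  have hoff' : ∀ e, e ≠ b → G (Sum.inr e) = Sum.inr (D'.next e) := fun e h1 => by
    rw [hG, Perm.mul_apply, swap_apply_of_ne_of_ne (by simp) (by simpa using h1)]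
    rfl
  -- the vertices at the ends of `a` and `b` are identified
  have hcyc : (G * I).SameCycle (Sum.inl (D.inv a)) (Sum.inr (D'.inv b)) := by
    have hs : G * I = Perm.sumCongr D.next D'.next * I * swap (I (Sum.inl a)) (I (Sum.inr b)) := by
      rw [hG, mul_assoc, swap_mul_involution hII, mul_assoc]
    rw [hs]
    refine (sameCycle_mul_swap_iff (by simp)).2 fun h => ?_
    have := mapRel_mk_eq_of_sameCycle_mul h
    rw [mapRel_mk_right, mapRel_mk_right] at this
    exact hsep this
  have R1 : ∀ k e, Reach D.next D.inv o k e → Reach G I (Sum.inl o) k (Sum.inl e) := by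
    intro k e he
    induction he with
    | base k => exact Reach.base k
    | @rot k e _ ih =>
      by_cases h : D.inv e = a
      · have h2 : I (Sum.inr (D'.inv b)) = Sum.inr b := by simp [hI, D'.inv_inv]
        rw [← D.inv_inv e, h] at ih
        have := (ih.sameCycle hcyc).rot
        rw [h2, hbG] at this
        rwa [h]
      · rw [← hoff _ h]
        exact ih.rot
    | step _ ih => exact ih.step
  obtain ⟨k', hk'k, hk'⟩ : ∃ k' ≤ k, Reach D.next D.inv o k' (D.next a) := by
    obtain ⟨c, hA', hC'⟩ := trace_append.1 hL.face.trace
    obtain ⟨-, rfl⟩ := trace_concat.1 hA'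
    rcases hk with hk | hk
    · rw [List.map_eq_nil_iff] at hk
      subst hk
      exact ⟨0, Nat.zero_le _, by rw [hC']; exact Reach.base 0⟩
    · refine ⟨_, hk, ?_⟩
      have := Reach.trace D.inv_inv hA' (Reach.base 0 : Reach D.next D.inv o 0 o)
      rwa [zero_add, ← List.length_map (f := D.lab)] at this
  have hRa : Reach G I (Sum.inl o) k (Sum.inr o') := by
    have hback : (G * I).SameCycle (Sum.inl (D.next a)) (Sum.inr (D'.inv b)) := by
      refine Perm.SameCycle.symm ⟨1, ?_⟩
      rw [zpow_one, Perm.mul_apply, ← hbG]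
      simp [hI, D'.inv_inv]
    have := ((R1 _ _ hk').sameCycle (hback.trans hcyc.symm)).rot
    have h2 : I (Sum.inl (D.inv a)) = Sum.inl a := by simp [hI, D.inv_inv]
    rw [h2, ha] at this
    exact this.mono hk'k
  have R2 : ∀ j e, Reach D'.next D'.inv o' j e → Reach G I (Sum.inl o) (k + j) (Sum.inr e) := by
    intro j e he
    induction he with
    | base j => exact hRa.mono (Nat.le_add_right _ _)
    | @rot j e _ ih =>
      by_cases h : D'.inv e = b
      · have h2 : I (Sum.inl (D.inv a)) = Sum.inl a := by simp [hI, D.inv_inv]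
        rw [← D'.inv_inv e, h] at ih
        have := (ih.sameCycle hcyc.symm).rot
        rw [h2, ha] at this
        rwa [h, hb]
      · rw [← hoff' _ h]
        exact ih.rot
    | step _ ih => exact ih.step
  -- Whatever is reachable after joining was reachable inside one of the two pieces, so the radius
  -- bounds of the pieces apply.
  have R3 : ∀ j e, Reach G I (Sum.inl o) j e →
      Sum.elim (fun e => ∃ j, Reach D.next D.inv o j e)
        (fun e => ∃ j, Reach D'.next D'.inv o' j e) e := by
    intro j e he
    induction he with
    | base => exact ⟨0, Reach.base 0⟩
    | @rot j e _ ih =>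
      rcases e with e | e
      · obtain ⟨j, hj⟩ := ih
        by_cases h : D.inv e = a
        · rw [show I (Sum.inl e) = Sum.inl a from congrArg Sum.inl h, ha]
          exact ⟨0, Reach.base 0⟩
        · rw [show I (Sum.inl e) = Sum.inl (D.inv e) from rfl, hoff _ h]
          exact ⟨j, hj.rot⟩
      · obtain ⟨j, hj⟩ := ih
        by_cases h : D'.inv e = b
        · rw [show I (Sum.inr e) = Sum.inr b from congrArg Sum.inr h, hbG]
          exact ⟨k', hk'⟩
        · rw [show I (Sum.inr e) = Sum.inr (D'.inv e) from rfl, hoff' _ h]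
          exact ⟨j, hj.rot⟩
    | @step j e _ ih =>
      rcases e with e | e
      · obtain ⟨j, hj⟩ := ih
        exact ⟨_, hj.step⟩
      · obtain ⟨j, hj⟩ := ih
        exact ⟨_, hj.step⟩
  have hgood : ∀ e, e ∉ (A ++ [a]).map Sum.inl ++ (B ++ [b]).map Sum.inr ++ C.map Sum.inl →
      (I e = G e ∧ G (G e) = e) ∨ ∃ x L, e ∈ L ∧ IsFace G x L ∧
        IsCellLabel X (L.map (Sum.elim D.lab D'.lab)) := by
    rintro (e | e) he
    · have he' : e ∉ A ++ [a] ++ C := fun h => he (by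
        simp only [List.mem_append] at h ⊢
        exact h.imp (fun h => Or.inl (List.mem_map_of_mem (List.mem_append.2 h)))
          (fun h => List.mem_map_of_mem h))
      have hcl : ∀ z, D.next.SameCycle e z → z ≠ a := fun z hz hza =>
        he' (hL.face.mem_of_sameCycle (y := z) (by simp [hza]) hz.symm)
      rcases hL.good e he' with ⟨h1, h2⟩ | ⟨x, L, h1, h2, h3⟩
      · left
        rw [hoff _ (hcl e (Perm.SameCycle.refl _ _)), hoff _ (hcl _ ⟨1, by simp⟩), h2]
        exact ⟨congrArg Sum.inl h1, rfl⟩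
      · refine Or.inr ⟨Sum.inl x, L.map Sum.inl, List.mem_map_of_mem h1, ?_, ?_⟩
        · refine h2.map _ Sum.inl_injective fun z hz => hoff _ (hcl z ?_)
          exact ((h2.mem_iff.1 h1).symm).trans (h2.mem_iff.1 hz)
        · rw [List.map_map]
          exact h3
    · have he' : e ∉ B ++ [b] := fun h => he (List.mem_append_left _
        (List.mem_append_right _ (List.mem_map_of_mem h)))
      have hcl : ∀ z, D'.next.SameCycle e z → z ≠ b := fun z hz hza =>
        he' (hL'.face.mem_of_sameCycle (y := z) (by simp [hza]) hz.symm)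
      rcases hL'.good e he' with ⟨h1, h2⟩ | ⟨x, L, h1, h2, h3⟩
      · left
        rw [hoff' _ (hcl e (Perm.SameCycle.refl _ _)), hoff' _ (hcl _ ⟨1, by simp⟩), h2]
        exact ⟨congrArg Sum.inr h1, rfl⟩
      · refine Or.inr ⟨Sum.inr x, L.map Sum.inr, List.mem_map_of_mem h1, ?_, ?_⟩
        · refine h2.map _ Sum.inr_injective fun z hz => hoff' _ (hcl z ?_)
          exact ((h2.mem_iff.1 h1).symm).trans (h2.mem_iff.1 hz)
        · rw [List.map_map]
          exact h3
  have hrad : ∀ j e, Reach G I (Sum.inl o) j e → Reach G I (Sum.inl o) (max m (k + m')) e := by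
    intro j e he
    have := R3 j e he
    rcases e with e | e
    · obtain ⟨j, hj⟩ := this
      exact (R1 _ _ (hL.radius _ _ hj)).mono (le_max_left _ _)
    · obtain ⟨j, hj⟩ := this
      exact (R2 _ _ (hL'.radius _ _ hj)).mono (le_max_right _ _)
  have hmap : ((A ++ [a]).map Sum.inl ++ (B ++ [b]).map Sum.inr ++ C.map Sum.inl).map
      (Sum.elim D.lab D'.lab) =
      (A ++ [a]).map D.lab ++ (B ++ [b]).map D'.lab ++ C.map D.lab := by
    simp only [List.map_append, List.map_map, Sum.elim_comp_inl, Sum.elim_comp_inr]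
  exact ⟨⟨D.E ⊕ D'.E, (D.sum D').finite, G, I, hII, (D.sum D').inv_ne, Sum.elim D.lab D'.lab,
    (D.sum D').lab_inv, hsrc, genus_mul_swap hII (D.sum D').genus hne (Or.inr hsep)⟩,
    Sum.inl o, _, ⟨hface, hgood, hrad⟩, hmap, hv⟩

/-- The outer face is divided in two. If `a` and `b` end at different vertices, these become
identified, which equality of their images permits; if they end at one vertex, the loop `B ++ [b]`
is pinched off. The genus and the radius about `o` survive in both cases. -/
theorem PlanarMap.exists_cut {D : PlanarMap X} {o a b : D.E} {A B C : List D.E} {m : ℕ}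
    (h : D.Fills o ((A ++ [a]) ++ (B ++ [b]) ++ C) m) (hlab : X.tgt (D.lab a) = X.tgt (D.lab b)) :
    ∃ (next : Perm D.E) (h1 : _) (h2 : _),
      let D' : PlanarMap X := ⟨D.E, D.finite, next, D.inv, D.inv_inv, D.inv_ne, D.lab,
        D.lab_inv, h1, h2⟩
      IsFace next o ((A ++ [a]) ++ C) ∧ IsFace next (D.next a) (B ++ [b]) ∧
      (∀ e, e ∉ (A ++ [a]) ++ C → e ∉ B ++ [b] → D'.GoodFace e) ∧
      ∀ k e, Reach next D.inv o k e → Reach next D.inv o m e := by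
  classical
  have := D.finite
  have hcyc : D.next.SameCycle a b := (h.face.mem_iff.1 (by simp : a ∈ _)).symm.trans
    (h.face.mem_iff.1 (by simp))
  have hab : a ≠ b := by
    rintro rfl
    have := h.face.nodup
    simp [List.nodup_append] at this
  obtain ⟨f1, f2⟩ := h.face.cut
  have hoff : ∀ e, e ≠ a → e ≠ b → (D.next * swap a b) e = D.next e := fun e h1 h2 => by
    rw [Perm.mul_apply, swap_apply_of_ne_of_ne h1 h2]
  refine ⟨D.next * swap a b, ?_, genus_mul_swap D.inv_inv D.genus hab (Or.inl hcyc), f1, f2,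
    ?_, ?_⟩
  · intro e
    rw [Perm.mul_apply, D.src_lab_next, swap_apply_def]
    split_ifs with h1 h2
    · rw [h1, hlab]
    · rw [h2, hlab]
    · rfl
  · intro e he1 he2
    have he : e ∉ (A ++ [a]) ++ (B ++ [b]) ++ C := fun h => by
      rcases List.mem_append.1 h with h | h
      · rcases List.mem_append.1 h with h | h
        · exact he1 (List.mem_append_left _ h)
        · exact he2 h
      · exact he1 (List.mem_append_right _ h)
    have hcl : ∀ z, D.next.SameCycle e z → (D.next * swap a b) z = D.next z := fun z hz => by
      refine hoff z ?_ ?_ <;> rintro rfl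
      · exact he (h.face.mem_of_sameCycle (y := z) (by simp) hz.symm)
      · exact he (h.face.mem_of_sameCycle (y := z) (by simp) hz.symm)
    rcases h.good e he with ⟨h1, h2⟩ | ⟨x, L, h1, h2, h3⟩
    · left
      change D.inv e = (D.next * swap a b) e ∧
        (D.next * swap a b) ((D.next * swap a b) e) = e
      rw [hcl e (Perm.SameCycle.refl _ _), hcl _ ⟨1, by simp⟩]
      exact ⟨h1, h2⟩
    · refine Or.inr ⟨x, L, h1, h2.congr fun z hz => hcl z ?_, h3⟩
      exact ((h2.mem_iff.1 h1).symm).trans (h2.mem_iff.1 hz)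
  · exact reach_mul_swap D.inv_inv D.inv_ne D.genus hab hcyc (f1.mem_iff.1 (by simp)) h.radius

/-- The closed subpath `q` is cut off as a face of its own and becomes a 2-cell. Since `p` is
nonempty, the base dart stays on the outer face. -/
theorem HasDiagram.cut {v y : X.V} {p q r : List X.E} {m : ℕ} (h : HasDiagram X v (p ++ q ++ r) m)
    (hp : p ≠ []) (hq : q ≠ []) (hvp : X.IsPath v p y) (hqy : X.IsPath y q y)
    (hcell : IsCellLabel X q) : HasDiagram X v (p ++ r) m := by
  obtain ⟨D, o, L, hL, hw, hv⟩ := h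
  obtain ⟨L', C, rfl, hw', rfl⟩ := List.map_eq_append_iff.1 hw
  obtain ⟨A, B, rfl, rfl, rfl⟩ := List.map_eq_append_iff.1 hw'
  obtain ⟨A, a, rfl⟩ := List.eq_nil_or_concat' A |>.resolve_left fun h => hp (by simp [h])
  obtain ⟨B, b, rfl⟩ := List.eq_nil_or_concat' B |>.resolve_left fun h => hq (by simp [h])
  rw [List.map_append] at hvp hqy
  have hlab := (isPath_concat.1 hvp).2.trans (isPath_concat.1 hqy).2.symm
  obtain ⟨next, h1, h2, f1, f2, hg, hr⟩ := PlanarMap.exists_cut hL hlab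
  refine ⟨⟨D.E, D.finite, next, D.inv, D.inv_inv, D.inv_ne, D.lab, D.lab_inv, h1, h2⟩, o,
    A ++ [a] ++ C, ⟨f1, fun e he => ?_, hr⟩, List.map_append, hv⟩
  by_cases heB : e ∈ B ++ [b]
  · exact Or.inr ⟨_, _, heB, f2, hcell⟩
  · exact hg e he heB

/-- The backtrack is cut off as a bigon. If its sides form one edge, the cut has already detached
it; otherwise closing it up glues its sides and leaves a detached single edge. Both leftovers are
the bigon components that `GoodFace` tolerates. -/
theorem HasDiagram.fold {v : X.V} {p r : List X.E} {x : X.E} {m : ℕ}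
    (h : HasDiagram X v (p ++ [x, X.inv x] ++ r) m) (hp : p ≠ []) :
    HasDiagram X v (p ++ r) m := by
  classical
  obtain ⟨D, o, L, hL, hw, hv⟩ := h
  obtain ⟨L', C, rfl, hw', rfl⟩ := List.map_eq_append_iff.1 hw
  obtain ⟨A, B, rfl, rfl, hB⟩ := List.map_eq_append_iff.1 hw'
  obtain ⟨A, a, rfl⟩ := List.eq_nil_or_concat' A |>.resolve_left fun h => hp (by simp [h])
  obtain ⟨b, c, rfl⟩ : ∃ b c, B = [b] ++ [c] := by
    rcases B with - | ⟨b, - | ⟨c, - | ⟨d, B⟩⟩⟩ <;> simp at hB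
    exact ⟨b, c, rfl⟩
  simp only [List.singleton_append, List.map_cons, List.map_nil, List.cons.injEq, and_true] at hB
  have := D.finite
  have hab : D.next a = b := by
    obtain ⟨_, h, -⟩ := trace_append.1 hL.face.trace
    obtain ⟨_, h, h'⟩ := trace_append.1 h
    obtain ⟨-, rfl⟩ := trace_concat.1 h
    exact h'.1.symm
  have hlabc : D.lab c = X.inv (D.lab b) := by rw [hB.1, hB.2]
  have hlab : X.tgt (D.lab a) = X.tgt (D.lab c) := by
    rw [← D.src_lab_next, hab, hlabc, OneComplex.tgt, X.inv_inv]
  obtain ⟨next, h1, h2, f1, f2, hg, hr⟩ := PlanarMap.exists_cut hL hlab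
  set D' : PlanarMap X := ⟨D.E, D.finite, next, D.inv, D.inv_inv, D.inv_ne, D.lab,
        D.lab_inv, h1, h2⟩ with hD'
  rw [hab] at f2
  have hbc : next b = c := f2.trace.2.1.symm
  have hcb : next c = b := by
    have := f2.trace.2.2
    rw [hbc] at this
    exact this
  have hne : b ≠ c := by
    have := f2.nodup
    simpa using this
  have hnb : ∀ e ∈ A ++ [a] ++ C, e ≠ b ∧ e ≠ c := by
    intro e he
    have hnd := hL.face.nodup
    simp only [List.nodup_append, List.mem_append, List.mem_singleton] at hnd he
    obtain ⟨⟨-, -, hAB⟩, -, hABC⟩ := hnd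
    rcases he with he | he
    · exact ⟨hAB e he b (Or.inl rfl), hAB e he c (Or.inr rfl)⟩
    · exact ⟨(hABC b (Or.inr (Or.inl rfl)) e he).symm, (hABC c (Or.inr (Or.inr rfl)) e he).symm⟩
  replace hg : ∀ e : D.E, e ∉ A ++ [a] ++ C → e ∉ [b] ++ [c] →
      (D.inv e = next e ∧ next (next e) = e) ∨ ∃ x L, e ∈ L ∧ IsFace next x L ∧
        IsCellLabel X (L.map D.lab) := hg
  by_cases hi : D.inv b = c
  · refine ⟨D', o, A ++ [a] ++ C, ⟨f1, fun e he => ?_, hr⟩, List.map_append, hv⟩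
    by_cases heB : e ∈ [b] ++ [c]
    · left
      suffices D.inv e = next e ∧ next (next e) = e from this
      rw [List.singleton_append, List.mem_pair] at heB
      rcases heB with rfl | rfl
      · rw [hbc, hi, hcb]
        exact ⟨rfl, rfl⟩
      · rw [hcb, hbc, ← hi, D.inv_inv]
        exact ⟨rfl, rfl⟩
    · exact hg e he heB
  · have hJ := rePair_apply D.inv_inv D.inv_ne hne hi
    have hob := hnb o f1.head_mem
    have hgood : ∀ e : D.E, e ∉ A ++ [a] ++ C →
        (rePair D.inv b c e = next e ∧ next (next e) = e) ∨ ∃ x L, e ∈ L ∧ IsFace next x L ∧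
          IsCellLabel X (L.map D.lab) := by
      intro e he
      by_cases heB : e ∈ [b] ++ [c]
      · left
        rw [List.singleton_append, List.mem_pair] at heB
        rw [hJ]
        rcases heB with rfl | rfl
        · simp [hbc, hcb]
        · simp [hbc, hcb, hne.symm]
      · refine (hg e he heB).imp_left ?_
        rw [List.singleton_append, List.mem_pair] at heB
        rintro ⟨h3, h4⟩
        refine ⟨?_, h4⟩
        -- A detached bigon elsewhere is untouched by the gluing: `e = inv b` would force `e = next
        -- b = c`, and likewise with `b` and `c` exchanged.
        have h5 : ∀ z, e ≠ D.inv z ∨ e = next z := by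
          intro z
          by_cases h : e = D.inv z
          · right
            have : next e = z := by rw [← h3, h, D.inv_inv]
            rw [← this, h4]
          · exact Or.inl h
        rw [hJ, if_neg fun h => heB (Or.inl h), if_neg fun h => heB (Or.inr h),
          if_neg ((h5 b).resolve_right fun h => heB (Or.inr (h.trans hbc))),
          if_neg ((h5 c).resolve_right fun h => heB (Or.inl (h.trans hcb)))]
        exact h3
    exact ⟨D'.closeBigon b c hne hi hbc hcb hlabc, o, A ++ [a] ++ C,
      ⟨f1, hgood, reach_rePair D.inv_inv D.inv_ne hne hi hbc hcb hob.1 hob.2 hr⟩,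
      List.map_append, hv⟩

end Operations
end ShortcutGraph

namespace ShortcutGraph

open Equiv

/-! ### Restriction to a component -/

section Restrict

variable {E : Type*}

theorem trace_subtypePerm {g : Perm E} {p : E → Prop} (h : ∀ x, p (g x) ↔ p x)
    {x y : {e // p e}} {l : List {e // p e}} :
    Trace (g.subtypePerm h) x l y ↔ Trace g x.1 (l.map Subtype.val) y.1 := by
  induction l generalizing x with
  | nil => exact Subtype.ext_iff
  | cons e l ih => exact and_congr Subtype.ext_iff ih

theorem IsFace.exists_subtypePerm {g : Perm E} {p : E → Prop} (h : ∀ x, p (g x) ↔ p x) {x : E}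
    {L : List E} (hL : IsFace g x L) (hx : p x) :
    ∃ L' : List {e // p e}, L'.map Subtype.val = L ∧ IsFace (g.subtypePerm h) ⟨x, hx⟩ L' := by
  have hp : ∀ e ∈ L, p e := by
    intro e he
    obtain ⟨j, rfl⟩ := hL.mem_iff.1 he
    have := ((g.subtypePerm h ^ j) ⟨x, hx⟩).2
    rwa [Perm.subtypePerm_zpow] at this
  lift L to List {e // p e} using hp
  exact ⟨L, rfl, fun h => hL.ne_nil (by rw [h]; rfl), hL.nodup.of_map, (trace_subtypePerm h).2 hL.trace⟩

/-- In a planar map, each component is a sphere. -/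
theorem euler_of_component [Finite E] {g i : Perm E} (hi : ∀ x, i (i x) = x) (hne : ∀ x, i x ≠ x)
    (hN : Nat.card E + 4 * numClasses (mapRel g i) ≤ 2 * numCycles g + 2 * numCycles (g * i))
    {p : E → Prop} (hg : ∀ x, p (g x) ↔ p x) (hip : ∀ x, p (i x) ↔ p x)
    (hp : numClasses (mapRel (g.subtypePerm hg) (i.subtypePerm hip)) = 1) :
    2 * numCycles (g.subtypePerm hg * i.subtypePerm hip) + 2 * numCycles (g.subtypePerm hg) =
      Nat.card {e // p e} + 4 := by
  classical
  have hg' : ∀ x, ¬ p (g x) ↔ ¬ p x := fun x => not_congr (hg x)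
  have hip' : ∀ x, ¬ p (i x) ↔ ¬ p x := fun x => not_congr (hip x)
  let G : Perm {x // ¬ p x} := g.subtypePerm hg'
  let I : Perm {x // ¬ p x} := i.subtypePerm hip'
  -- Euler's inequality for the component and for its complement add up to the reverse of `hN`, so
  -- neither has any slack.
  have e1 := numCycles_add_numCycles_mul_le (g.subtypePerm hg) (i.subtypePerm hip)
    (by rintro ⟨x, hx⟩; exact Subtype.ext (hi x))
    (by rintro ⟨x, hx⟩ h; exact hne x (congrArg Subtype.val h))
  have e2 := numCycles_add_numCycles_mul_le G I
    (by rintro ⟨x, hx⟩; exact Subtype.ext (hi x))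
    (by rintro ⟨x, hx⟩ h; exact hne x (congrArg Subtype.val h))
  have c1 : numClasses (mapRel g i) =
      numClasses (mapRel (g.subtypePerm hg) (i.subtypePerm hip)) +
      numClasses (mapRel G I) := by
    rw [← numClasses_mapRel_sumCongr]
    refine (numClasses_mapRel_equiv (Equiv.sumCompl p) ?_ ?_).symm <;>
    · rintro (x | x) <;> simp [G, I]
  have c2 : numCycles g = numCycles (g.subtypePerm hg) + numCycles G := by
    rw [← numCycles_sumCongr]
    refine (numCycles_equiv (Equiv.sumCompl p) ?_).symm
    rintro (x | x) <;> simp [G]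
  have c3 : numCycles (g * i) = numCycles (g.subtypePerm hg * i.subtypePerm hip) +
      numCycles (G * I) := by
    rw [← numCycles_sumCongr]
    refine (numCycles_equiv (Equiv.sumCompl p) ?_).symm
    rintro (x | x) <;> rfl
  have c4 : Nat.card E = Nat.card {e // p e} + Nat.card {e // ¬ p e} := by
    rw [← Nat.card_sum]
    exact (Nat.card_congr (Equiv.sumCompl p)).symm
  omega

end Restrict

/-! ### Reversal of edge paths -/

section Paths

theorem isPath_reversePath {Y : OneComplex.{u}} {l : List Y.E} {x y : Y.V}
    (h : Y.IsPath x l y) : Y.IsPath y (Y.reversePath l) x := by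
  induction l generalizing x with
  | nil => exact Eq.symm h
  | cons e l ih =>
    obtain ⟨rfl, h⟩ := h
    rw [OneComplex.reversePath, List.map_cons, List.reverse_cons]
    refine isPath_concat.2 ⟨ih h, ?_⟩
    rw [OneComplex.tgt, Y.inv_inv]

theorem reversePath_reversePath {Y : OneComplex.{u}} (l : List Y.E) :
    Y.reversePath (Y.reversePath l) = l := by
  simp only [OneComplex.reversePath, List.map_reverse, List.reverse_reverse, List.map_map]
  conv_rhs => rw [← List.map_id l]
  exact List.map_congr_left fun e _ => Y.inv_inv e

theorem reversePath_cons {Y : OneComplex.{u}} (e : Y.E) (l : List Y.E) :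
    Y.reversePath (e :: l) = Y.reversePath l ++ [Y.inv e] := by
  simp [OneComplex.reversePath]

theorem length_reversePath {Y : OneComplex.{u}} (l : List Y.E) :
    (Y.reversePath l).length = l.length := by
  simp [OneComplex.reversePath]

end Paths

/-! ### From planar maps to disk diagrams -/

section Realize

variable {X : TwoComplex.{u}}

/-- Only the component of `o` is kept, with the cycles of `next * inv` as vertices. Going through
the base point, radius `m` gives diameter `2 * m`. -/
theorem HasDiagram.exists_diskDiagram {v : X.V} {w : List X.E} {m : ℕ} (h : HasDiagram X v w m) :
    ∃ D : DiskDiagram X, D.boundaryPath = w ∧ D.DiamLE (2 * m) := by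
  classical
  obtain ⟨D, o, L, hL, rfl, -⟩ := h
  have := D.finite
  let p : D.E → Prop := fun e => Quot.mk (mapRel D.next D.inv) o = Quot.mk _ e
  have hg : ∀ x, p (D.next x) ↔ p x := fun x => by simp only [p, mapRel_mk_left]
  have hi : ∀ x, p (D.inv x) ↔ p x := fun x => by simp only [p, mapRel_mk_right]
  let g := D.next.subtypePerm hg
  let i := D.inv.subtypePerm hi
  have hii : ∀ x, i (i x) = x := fun x => Subtype.ext (D.inv_inv x)
  let V := Quotient (Perm.SameCycle.setoid (g * i))
  let src : {e // p e} → V := Quotient.mk _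
  have hsrc : ∀ e, src (g e) = src (i e) := fun e => Quotient.sound
    (Perm.SameCycle.symm ⟨1, by rw [zpow_one, Perm.mul_apply, hii]⟩)
  have ho : p o := rfl
  have hone : numClasses (mapRel g i) = 1 := by
    refine Nat.card_eq_one_iff_unique.2 ⟨⟨?_⟩, ⟨Quot.mk _ ⟨o, ho⟩⟩⟩
    have key : ∀ k e, Reach D.next D.inv o k e → ∀ he : p e,
        Quot.mk (mapRel g i) ⟨o, ho⟩ = Quot.mk (mapRel g i) ⟨e, he⟩ := by
      intro k e he
      induction he with
      | base => exact fun _ => rfl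
      | @rot k e _ ih =>
        intro he
        have he' : p e := (hi _).1 ((hg _).1 he)
        rw [ih he', ← mapRel_mk_right g i ⟨e, he'⟩, ← mapRel_mk_left g i]
        rfl
      | @step k e _ ih =>
        intro he
        have he' : p e := (hi _).1 he
        rw [ih he', ← mapRel_mk_right g i ⟨e, he'⟩]
        rfl
    have key' : ∀ e, Quot.mk (mapRel g i) ⟨o, ho⟩ = Quot.mk (mapRel g i) e := by
      rintro ⟨e, he⟩
      obtain ⟨k, hk⟩ := (reach_iff D.inv_inv).2 he
      exact key k e hk he
    rintro ⟨x⟩ ⟨y⟩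
    rw [← key' x, ← key' y]
  have heuler : 2 * Nat.card V + 2 * Nat.card (Quotient (Perm.SameCycle.setoid g)) =
      Nat.card {e // p e} + 4 := by
    rw [← euler_of_component D.inv_inv D.inv_ne D.genus hg hi hone, numCycles_eq_card,
      numCycles_eq_card]
  let Y : OneComplex.{0} := ⟨V, {e // p e}, src, i, hii,
    fun x h => D.inv_ne x (congrArg Subtype.val h)⟩
  have hYperm : Y.invPerm = i := by ext x; rfl
  have hpath : ∀ k e, Reach D.next D.inv o k e → ∀ he : p e,
      ∃ l : List Y.E, Y.IsPath (src ⟨o, ho⟩) l (src ⟨e, he⟩) ∧ l.length ≤ k := by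
    intro k e he
    induction he with
    | base => exact fun _ => ⟨[], rfl, Nat.zero_le _⟩
    | @rot k e _ ih =>
      intro he
      have he' : p e := (hi _).1 ((hg _).1 he)
      obtain ⟨l, hl, hlk⟩ := ih he'
      refine ⟨l, ?_, hlk⟩
      have : src ⟨D.next (D.inv e), he⟩ = src ⟨e, he'⟩ := by
        have := hsrc (i ⟨e, he'⟩)
        rwa [hii] at this
      rwa [this]
    | @step k e _ ih =>
      intro he
      have he' : p e := (hi _).1 he
      obtain ⟨l, hl, hlk⟩ := ih he'
      exact ⟨l ++ [⟨e, he'⟩], isPath_concat.2 ⟨hl, rfl⟩, by simpa using hlk⟩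
  have hrad : ∀ x : V, ∃ l : List Y.E, Y.IsPath (src ⟨o, ho⟩) l x ∧ l.length ≤ m := by
    intro x
    induction x using Quotient.ind with | _ e =>
    obtain ⟨k, hk⟩ := (reach_iff D.inv_inv).2 e.2
    exact hpath m e (hL.radius k e hk) e.2
  have hdiam : ∀ x y : V, ∃ l : List Y.E, Y.IsPath x l y ∧ l.length ≤ 2 * m := by
    intro x y
    obtain ⟨l, hl, hlm⟩ := hrad x
    obtain ⟨l', hl', hlm'⟩ := hrad y
    refine ⟨Y.reversePath l ++ l', isPath_append.2 ⟨_, isPath_reversePath hl, hl'⟩, ?_⟩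
    rw [List.length_append, length_reversePath]
    omega
  let mapE : {e // p e} → X.E := fun e => D.lab e
  have hmap : ∀ e e', (g * i).SameCycle e e' → X.src (mapE e) = X.src (mapE e') := by
    intro e e' h
    refine congrArg (Quot.lift (fun e => X.src (mapE e)) ?_) (mk_eq_mk_iff_sameCycle.2 h)
    rintro x y rfl
    change X.src (D.lab x) = X.src (D.lab (D.next (D.inv x)))
    rw [D.src_lab_next, D.lab_inv, OneComplex.tgt, X.inv_inv]
  obtain ⟨Lo, hLo, hLoF⟩ := hL.face.exists_subtypePerm hg ho
  have hface : ∀ e : {e // p e}, ¬ g.SameCycle ⟨o, ho⟩ e → ∃ e', g.SameCycle e e' ∧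
      ∃ c : X.Cell,
        (List.iterate g e' (Function.minimalPeriod g e')).map mapE = X.bdry c ∨
        (List.iterate g e' (Function.minimalPeriod g e')).map mapE =
          X.reversePath (X.bdry c) := by
    intro e he
    have heL : e.1 ∉ L := by
      intro h
      rw [← hLo] at h
      obtain ⟨e', he', hee'⟩ := List.mem_map.1 h
      rw [Subtype.ext hee'] at he'
      exact he (hLoF.mem_iff.1 he')
    rcases hL.good e.1 heL with ⟨h1, h2⟩ | ⟨x, L', h1, h2, h3⟩
    -- A bigon forming a component by itself would contain the base dart and thus lie on the outer
    -- face.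
    · exfalso
      have h4 : D.inv (D.next e.1) = e.1 := by rw [← h1, D.inv_inv]
      have := congrArg (Quot.lift (fun x => x = e.1 ∨ x = D.next e.1) (by
        rintro x y (rfl | rfl) <;> apply propext
        · constructor
          · rintro (rfl | rfl)
            · exact Or.inr rfl
            · exact Or.inl h2
          · rintro (h | h)
            · exact Or.inr (D.next.injective (h.trans h2.symm))
            · exact Or.inl (D.next.injective h)
        · constructor
          · rintro (rfl | rfl)
            · exact Or.inr h1
            · exact Or.inl h4
          · rintro (h | h)
            · exact Or.inr (D.inv.injective (h.trans h4.symm))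
            · exact Or.inl (D.inv.injective (h.trans h1.symm)))) e.2
      rcases this.mpr (Or.inl rfl) with h | h
      · exact heL (h ▸ hL.face.head_mem)
      · refine heL (hL.face.mem_of_sameCycle hL.face.head_mem ?_)
        rw [h]
        exact Perm.SameCycle.symm ⟨1, by simp⟩
    · have hx : p x := e.2.trans (mapRel_mk_eq_of_sameCycle (h2.mem_iff.1 h1)).symm
      obtain ⟨L'', rfl, h4⟩ := h2.exists_subtypePerm hg hx
      refine ⟨⟨x, hx⟩, ?_, ?_⟩
      · obtain ⟨e', he', hee'⟩ := List.mem_map.1 h1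
        rw [Subtype.ext hee'] at he'
        exact (h4.mem_iff.1 he').symm
      · have : List.iterate g ⟨x, hx⟩ (Function.minimalPeriod g ⟨x, hx⟩) = L'' := h4.iterate_eq
        rw [this]
        rw [List.map_map] at h3
        exact h3
  refine ⟨{ Y with
    finite_V := inferInstanceAs (Finite V)
    finite_E := inferInstanceAs (Finite {e // p e})
    next := g
    src_next := hsrc
    sameCycle_of_src_eq := fun e e' h => by
      have := Quotient.exact h
      rw [← hYperm] at this
      exact this
    connected := fun x y => (hdiam x y).imp fun l hl => hl.1
    euler := heuler
    outer := ⟨o, ho⟩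
    mapV := Quotient.lift (fun e => X.src (mapE e)) hmap
    mapE := mapE
    map_src := fun e => rfl
    map_inv := fun e => D.lab_inv e
    face_map := hface }, ?_, hdiam⟩
  have : List.iterate g ⟨o, ho⟩ (Function.minimalPeriod g ⟨o, ho⟩) = Lo := hLoF.iterate_eq
  change (List.iterate g ⟨o, ho⟩ (Function.minimalPeriod g ⟨o, ho⟩)).map mapE = _
  rw [this, ← hLo, List.map_map]
  rfl

end Realize

/-! ### Van Kampen's lemma with control of the radius -/

section VanKampen

variable {X : TwoComplex.{u}}

theorem HasDiagram.conj {v y : X.V} {u w : List X.E} {m : ℕ} (hu : X.IsPath v u y)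
    (h : HasDiagram X y w m) : HasDiagram X v (u ++ w ++ X.reversePath u) (u.length + m) := by
  induction u generalizing v with
  | nil =>
    obtain rfl : v = y := hu
    simpa [OneComplex.reversePath] using h
  | cons e u ih =>
    obtain ⟨rfl, hu⟩ := hu
    have := HasDiagram.join (p := [e]) (q := [X.inv e]) (k := 1) (hasDiagram_segment e) (by simp)
      ⟨rfl, rfl⟩ (ih hu) (Or.inr le_rfl)
    rw [reversePath_cons]
    refine HasDiagram.mono (by simpa using this) ?_
    simp only [List.length_cons]
    omega

theorem hasDiagram_spike {v y : X.V} {u : List X.E} (hu : X.IsPath v u y) (hne : u ≠ []) :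
    HasDiagram X v (u ++ X.reversePath u) u.length := by
  obtain ⟨u, e, rfl⟩ := List.eq_nil_or_concat' u |>.resolve_left hne
  obtain ⟨hu, -⟩ := isPath_concat.1 hu
  have := HasDiagram.conj hu (hasDiagram_segment e)
  simpa [OneComplex.reversePath] using this

/-- In the spike with boundary `c c⁻¹`, the return path `c⁻¹` is cut off as a cell; this is why the
label condition concerns the reversed path. -/
theorem hasDiagram_of_isCellLabel {v : X.V} {c : List X.E} (hc : X.IsPath v c v) (hne : c ≠ [])
    (hcell : IsCellLabel X (X.reversePath c)) : HasDiagram X v c c.length := by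
  have := (hasDiagram_spike hc hne)
  rw [← List.append_nil (c ++ _)] at this
  have := this.cut hne (by simpa [OneComplex.reversePath] using hne) hc (isPath_reversePath hc) hcell
  simpa using this

/-- The element of the free group that is represented by an edge path, where the oriented edges are
encoded by `enc` as free generators and their inverses. -/
def pathWord {β E : Type*} (enc : E → β × Bool) (l : List E) : FreeGroup β :=
  FreeGroup.mk (l.map enc)

theorem pathWord_append {β E : Type*} (enc : E → β × Bool) (l m : List E) :
    pathWord enc (l ++ m) = pathWord enc l * pathWord enc m := by
  rw [pathWord, List.map_append, ← FreeGroup.mul_mk]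
  rfl

variable {β : Type*} {enc : X.E → β × Bool}

theorem pathWord_reversePath (hinv : ∀ e, enc (X.inv e) = ((enc e).1, !(enc e).2)) (l : List X.E) :
    pathWord enc (X.reversePath l) = (pathWord enc l)⁻¹ := by
  rw [pathWord, pathWord, FreeGroup.inv_mk]
  congr 1
  simp only [OneComplex.reversePath, FreeGroup.invRev, List.map_reverse, List.map_map]
  congr 2
  funext e
  exact hinv e

/-- Each free reduction of the tail `t` is a fold, and the nonempty prefix `l` shields the base
dart. -/
theorem HasDiagram.of_red (henc : Function.Injective enc)
    (hinv : ∀ e, enc (X.inv e) = ((enc e).1, !(enc e).2)) {v : X.V} {l : List X.E} {m : ℕ}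
    (hl : l ≠ []) {L : List (β × Bool)} (hL : FreeGroup.Red L []) {t : List X.E}
    (ht : t.map enc = L) (h : HasDiagram X v (l ++ t) m) : HasDiagram X v l m := by
  induction hL using Relation.ReflTransGen.head_induction_on generalizing t with
  | refl =>
    rw [List.map_eq_nil_iff] at ht
    simpa [ht] using h
  | @head L L' hs _ ih =>
    obtain @⟨L₁, L₂, x, b⟩ := hs
    obtain ⟨t₁, t', rfl, rfl, ht'⟩ := List.map_eq_append_iff.1 ht
    obtain ⟨e, t'', rfl, he, ht''⟩ := List.map_eq_cons_iff.1 ht'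
    obtain ⟨f, t₂, rfl, hf, rfl⟩ := List.map_eq_cons_iff.1 ht''
    have hef : f = X.inv e := henc (by rw [hf, hinv, he])
    refine ih (t := t₁ ++ t₂) (by simp) ?_
    have := HasDiagram.fold (p := l ++ t₁) (r := t₂) (x := e) (by simpa [hef] using h) (by simp [hl])
    simpa using this

/-- **Van Kampen's lemma** with control of diameters: if a closed path is, in the free group, a
product of conjugates of boundaries of 2-cells by short paths, then it bounds a disk diagram of
small diameter. -/
theorem exists_diskDiagram_of_mem_closure (henc : Function.Injective enc)
    (hinv : ∀ e, enc (X.inv e) = ((enc e).1, !(enc e).2)) {R : ℕ}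
    (hR : ∀ c, (X.bdry c).length ≤ R) {x : X.V} {l : List X.E} (hl : l ≠ []) (hlx : X.IsPath x l x)
    {m : ℕ} (hmem : pathWord enc l ∈ Subgroup.closure {g : FreeGroup β |
      ∃ (u : List X.E) (y : X.V) (c : X.Cell), X.IsPath x u y ∧ X.IsPath y (X.bdry c) y ∧
        u.length ≤ m ∧ g = pathWord enc u * pathWord enc (X.bdry c) * (pathWord enc u)⁻¹}) :
    ∃ D : DiskDiagram X, D.boundaryPath = l ∧ D.DiamLE (2 * (l.length + m + R)) := by
  set M := l.length + m + R
  -- `P g` says that every diagram of radius `M` can be enlarged, within radius `M`, so that its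
  -- boundary gains a tail spelling `g`. Quantifying over `w` makes `P` multiplicative.
  let P : FreeGroup β → Prop := fun g => ∀ w, w ≠ [] → X.IsPath x w x → HasDiagram X x w M →
    ∃ s, HasDiagram X x (w ++ s) M ∧ X.IsPath x s x ∧ pathWord enc s = g
  have hP1 : P 1 := fun w hw hwx h => ⟨[], by simpa using h, rfl, rfl⟩
  have hPmul : ∀ g h, P g → P h → P (g * h) := by
    intro g h hg hh w hw hwx hD
    obtain ⟨s, hs, hsx, rfl⟩ := hg w hw hwx hD
    obtain ⟨t, ht, htx, rfl⟩ := hh (w ++ s) (by simp [hw]) (isPath_append.2 ⟨x, hwx, hsx⟩) hs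
    exact ⟨s ++ t, by simpa using ht, isPath_append.2 ⟨x, hsx, htx⟩, pathWord_append _ _ _⟩
  have hPcell : ∀ (u : List X.E) (y : X.V) (c : List X.E), X.IsPath x u y → X.IsPath y c y →
      u.length ≤ m → c.length ≤ R → IsCellLabel X (X.reversePath c) →
      P (pathWord enc u * pathWord enc c * (pathWord enc u)⁻¹) := by
    intro u y c hu hc hum hcR hcell
    by_cases hne : c = []
    · have : pathWord enc c = 1 := by rw [hne]; rfl
      rw [this, mul_one, mul_inv_cancel]
      exact hP1
    · intro w hw hwx hD
      have h1 := HasDiagram.conj hu (hasDiagram_of_isCellLabel hc hne hcell)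
      rw [← List.append_nil w] at hD
      -- The lollipop is attached at the base point, so the new radius is a maximum and not a sum.
      have h2 := hD.join (k := 0) hw hwx h1 (Or.inl rfl)
      refine ⟨_, (by simpa using h2 : HasDiagram X x (w ++ (u ++ c ++ X.reversePath u)) _).mono ?_,
        isPath_append.2 ⟨y, isPath_append.2 ⟨y, hu, hc⟩, isPath_reversePath hu⟩, ?_⟩
      · omega
      · rw [pathWord_append, pathWord_append, pathWord_reversePath hinv]
  -- The inverse is carried along because `P` is not visibly closed under inversion; for a generator
  -- it comes from the reversed cell.
  have hPall : P (pathWord enc l) ∧ P (pathWord enc l)⁻¹ := by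
    generalize pathWord enc l = g at hmem
    induction hmem using Subgroup.closure_induction with
    | mem g hg =>
      obtain ⟨u, y, c, hu, hc, hum, rfl⟩ := hg
      refine ⟨hPcell u y _ hu hc hum (hR c) ⟨c, Or.inr rfl⟩, ?_⟩
      have := hPcell u y _ hu (isPath_reversePath hc) hum ((length_reversePath _).trans_le (hR c))
        ⟨c, Or.inl (reversePath_reversePath _)⟩
      rw [pathWord_reversePath hinv] at this
      convert this using 1
      group
    | one => exact ⟨hP1, by rwa [inv_one]⟩
    | mul g h _ _ hg hh =>
      exact ⟨hPmul _ _ hg.1 hh.1, by rw [mul_inv_rev]; exact hPmul _ _ hh.2 hg.2⟩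
    | inv g _ hg => exact ⟨hg.2, by rw [inv_inv]; exact hg.1⟩
  -- Starting from `l l⁻¹` makes the final boundary equal to `l` letter by letter, since only the
  -- tail `l⁻¹ s` gets reduced.
  have h0 : HasDiagram X x (l ++ X.reversePath l) M :=
    (hasDiagram_spike hlx hl).mono (by omega)
  obtain ⟨s, hs, -, hsl⟩ := hPall.1 _ (by simp [hl])
    (isPath_append.2 ⟨x, hlx, isPath_reversePath hlx⟩) h0
  rw [List.append_assoc] at hs
  refine (HasDiagram.of_red henc hinv hl (L := (X.reversePath l ++ s).map enc) ?_ rfl hs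
    ).exists_diskDiagram
  have h1 : pathWord enc (X.reversePath l ++ s) = 1 := by
    rw [pathWord_append, pathWord_reversePath hinv, hsl, inv_mul_cancel]
  obtain ⟨L, hL1, hL2⟩ := FreeGroup.Red.exact.1 (h1.trans FreeGroup.one_eq_mk)
  rwa [FreeGroup.Red.nil_iff.1 hL2] at hL1

end VanKampen

/-! ### Isometric cycles are detected on vertices -/

section IsometricCycles

variable {V : Type u} {Γ : SimpleGraph V}

/-- Of the four routes between points on two edges of an `n`-cycle, the one leaving the first edge
forwards and entering the second at its start runs along one arc, and the one doing the opposite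
runs along the other arc. The remaining routes are no shorter than the shorter arc. -/
theorem min_four_eq {n d t s : ℝ} (ht0 : 0 ≤ t) (ht1 : t ≤ 1) (hs0 : 0 ≤ s) (hs1 : s ≤ 1) :
    min (min (t + min d (n - d) + s) (t + min (d + 1) (n - (d + 1)) + (1 - s)))
      (min ((1 - t) + min (d - 1) (n - (d - 1)) + s) ((1 - t) + min d (n - d) + (1 - s))) =
    min (d + s - t) (n - (d + s - t)) := by
  apply le_antisymm
  · apply le_min
    · refine (min_le_right _ _).trans ((min_le_left _ _).trans ?_)
      have := min_le_left (d - 1) (n - (d - 1))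
      linarith
    · refine (min_le_left _ _).trans ((min_le_right _ _).trans ?_)
      have := min_le_right (d + 1) (n - (d + 1))
      linarith
  · refine le_min (le_min ?_ ?_) (le_min ?_ ?_)
    · rcases min_choice d (n - d) with h | h <;> rw [h]
      · exact (min_le_left _ _).trans (by linarith)
      · exact (min_le_right _ _).trans (by linarith)
    · rcases min_choice (d + 1) (n - (d + 1)) with h | h <;> rw [h]
      · exact (min_le_left _ _).trans (by linarith)
      · exact (min_le_right _ _).trans (by linarith)
    · rcases min_choice (d - 1) (n - (d - 1)) with h | h <;> rw [h]
      · exact (min_le_left _ _).trans (by linarith)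
      · exact (min_le_right _ _).trans (by linarith)
    · rcases min_choice d (n - d) with h | h <;> rw [h]
      · exact (min_le_left _ _).trans (by linarith)
      · exact (min_le_right _ _).trans (by linarith)

theorem exists_append_eq {a b : V} (p : Γ.Walk a b) {i : ℕ} (hi : i ≤ p.length) :
    ∃ (c : V) (q : Γ.Walk a c) (r : Γ.Walk c b), p = q.append r ∧ q.length = i ∧
      q.length + r.length = p.length ∧ p.getVert i = c ∧
      ∀ k, p.getVert (i + k) = r.getVert k := by
  induction p generalizing i with
  | nil =>
    obtain rfl : i = 0 := by simpa using hi
    exact ⟨_, .nil, .nil, rfl, rfl, rfl, rfl, fun k => by simp⟩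
  | cons h p ih =>
    rcases i with - | i
    · exact ⟨_, .nil, .cons h p, rfl, rfl, by simp, rfl, fun k => by simp⟩
    · obtain ⟨c, q, r, h1, h2, h3, h4, h5⟩ := ih (i := i) (by simpa using hi)
      refine ⟨c, .cons h q, r, congrArg _ h1, congrArg (· + 1) h2, ?_, ?_, ?_⟩
      · simp only [SimpleGraph.Walk.length_cons]
        omega
      · simpa using h4
      · intro k
        rw [← h5, Nat.add_right_comm]
        simp

theorem dist_getVert_le {v : V} (p : Γ.Walk v v) {i j : ℕ} (hij : i ≤ j) (hj : j ≤ p.length) :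
    Γ.dist (p.getVert i) (p.getVert j) ≤ j - i ∧
      Γ.dist (p.getVert i) (p.getVert j) ≤ p.length - (j - i) := by
  obtain ⟨c, q, r, -, hq, hlen, hc, hr⟩ := exists_append_eq p (hij.trans hj)
  obtain ⟨d, q', r', -, hq', hlen', hd, -⟩ := exists_append_eq r (i := j - i) (by omega)
  have hj' : p.getVert j = d := by rw [← hd, ← hr]; congr 1; omega
  rw [hj', hc]
  constructor
  · exact (SimpleGraph.dist_le q').trans_eq hq'
  · rw [SimpleGraph.dist_comm]
    refine (SimpleGraph.dist_le (r'.append q)).trans ?_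
    rw [SimpleGraph.Walk.length_append]
    omega

/-- A cycle is isometric as soon as it is isometric on vertices. -/
theorem isIsometricCycle_of_forall_dist {v : V} (p : Γ.Walk v v) (hp : 3 ≤ p.length)
    (h : ∀ i j, i < j → j < p.length →
      min (j - i) (p.length - (j - i)) ≤ Γ.dist (p.getVert i) (p.getVert j)) :
    IsIsometricCycle p := by
  set n := p.length with hn
  have hdist : ∀ i j, i ≤ j → j ≤ n →
      Γ.dist (p.getVert i) (p.getVert j) = min (j - i) (n - (j - i)) := by
    intro i j hij hj
    refine le_antisymm (le_min (dist_getVert_le p hij hj).1 (dist_getVert_le p hij hj).2) ?_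
    rcases hij.eq_or_lt with rfl | hij
    · simp
    rcases hj.eq_or_lt with rfl | hj
    · rcases Nat.eq_zero_or_pos i with rfl | hi
      · simp
      · have h1 := h 0 i hi hij
        rw [SimpleGraph.Walk.getVert_length, SimpleGraph.dist_comm]
        rw [SimpleGraph.Walk.getVert_zero] at h1
        omega
    · exact h i j hij hj
  have hreal : ∀ i j, i ≤ j → j ≤ n →
      (Γ.dist (p.getVert i) (p.getVert j) : ℝ) = min ((j : ℝ) - i) (n - ((j : ℝ) - i)) := by
    intro i j hij hj
    rw [hdist i j hij hj]
    push_cast [Nat.cast_sub hij, Nat.cast_sub ((Nat.sub_le j i).trans hj)]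
    rfl
  have hreal' : ∀ i j, i ≤ j → j ≤ n →
      (Γ.dist (p.getVert j) (p.getVert i) : ℝ) = min ((j : ℝ) - i) (n - ((j : ℝ) - i)) := by
    intro i j hij hj
    rw [SimpleGraph.dist_comm, hreal i j hij hj]
  have hinj : ∀ i j, i ≤ j → j ≤ n → p.getVert i = p.getVert j → i = j ∨ (i = 0 ∧ j = n) := by
    intro i j hij hj heq
    have := hdist i j hij hj
    rw [heq, SimpleGraph.dist_self] at this
    omega
  have hinj' : ∀ i j, i ≤ n → j ≤ n → p.getVert i = p.getVert j →
      i = j ∨ (i = 0 ∧ j = n) ∨ (j = 0 ∧ i = n) := by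
    intro i j hi hj heq
    rcases le_total i j with hij | hij
    · have := hinj i j hij hj heq
      omega
    · have := hinj j i hij hi heq.symm
      omega
  refine ⟨by omega, fun x y hx hxn hy hyn => ?_⟩
  have hi : ⌊x⌋₊ < n := (Nat.floor_lt hx).2 hxn
  have hj : ⌊y⌋₊ < n := (Nat.floor_lt hy).2 hyn
  have hxe : x = ⌊x⌋₊ + Int.fract x := by
    rw [natCast_floor_eq_intCast_floor hx, Int.floor_add_fract]
  have hye : y = ⌊y⌋₊ + Int.fract y := by
    rw [natCast_floor_eq_intCast_floor hy, Int.floor_add_fract]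
  have ht0 := Int.fract_nonneg x
  have ht1 := Int.fract_lt_one x
  have hs0 := Int.fract_nonneg y
  have hs1 := Int.fract_lt_one y
  unfold imageDist circleDist edgePointDist
  generalize ⌊x⌋₊ = i at *
  generalize ⌊y⌋₊ = j at *
  generalize Int.fract x = t at *
  generalize Int.fract y = s at *
  subst hxe hye
  have hn3 : (3 : ℝ) ≤ n := by exact_mod_cast hp
  by_cases hij : i = j
  · subst hij
    rw [if_pos ⟨rfl, rfl⟩, add_sub_add_left_eq_sub, min_eq_left]
    have : |t - s| ≤ 1 := abs_le.2 ⟨by linarith, by linarith⟩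
    linarith
  rw [if_neg, if_neg]
  · rcases Nat.lt_or_gt_of_ne hij with hlt | hlt
    · have hlt' : (i : ℝ) + 1 ≤ j := by exact_mod_cast hlt
      have habs : |(i : ℝ) + t - (j + s)| = ((j : ℝ) - i) + s - t := by
        rw [abs_sub_comm, abs_of_nonneg] <;> linarith
      have e1 : ((j + 1 : ℕ) : ℝ) - i = (j - i) + 1 := by push_cast; ring
      have e2 : (j : ℝ) - (i + 1 : ℕ) = (j - i) - 1 := by push_cast; ring
      have e3 : ((j + 1 : ℕ) : ℝ) - (i + 1 : ℕ) = j - i := by push_cast; ring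
      rw [habs, hreal i j hlt.le hj.le, hreal i (j + 1) (by omega) hj, hreal (i + 1) j hlt hj.le,
        hreal (i + 1) (j + 1) (by omega) hj, e1, e2, e3]
      exact min_four_eq ht0 ht1.le hs0 hs1.le
    · have hlt' : (j : ℝ) + 1 ≤ i := by exact_mod_cast hlt
      have habs : |(i : ℝ) + t - (j + s)| = ((i : ℝ) - j) + t - s := by
        rw [abs_of_nonneg] <;> linarith
      have e1 : ((i + 1 : ℕ) : ℝ) - j = (i - j) + 1 := by push_cast; ring
      have e2 : (i : ℝ) - (j + 1 : ℕ) = (i - j) - 1 := by push_cast; ring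
      have e3 : ((i + 1 : ℕ) : ℝ) - (j + 1 : ℕ) = i - j := by push_cast; ring
      rw [habs, hreal' j i hlt.le hi.le, hreal' j (i + 1) (by omega) hi, hreal' (j + 1) i hlt hi.le,
        hreal' (j + 1) (i + 1) (by omega) hi, e1, e2, e3, ← min_four_eq hs0 hs1.le ht0 ht1.le,
        min_min_min_comm]
      congr 2 <;> ring
  -- Here `3 ≤ p.length` is essential: the two edges of a closed walk of length 2 are reverses of
  -- each other.
  · rintro ⟨h1, h2⟩
    have h1 := hinj' _ _ hi.le hj h1
    have h2 := hinj' _ _ hi hj.le h2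
    omega
  · rintro ⟨h1, -⟩
    have h1 := hinj' _ _ hi.le hj.le h1
    omega

/-- An isometric cycle realizes the full distance `n / 2` at antipodal points, so it is `ξ`-almost
isometric. -/
theorem IsStronglyShortcut.isShortcut (h : IsStronglyShortcut Γ) : IsShortcut Γ := by
  obtain ⟨hc, θ, ξ, h0, h1, hθ⟩ := h
  refine ⟨hc, θ, fun v p hp => hθ v p ⟨hp.1, fun x hx hx' => ?_⟩⟩
  have hpos : (0 : ℝ) < p.length := by exact_mod_cast hp.1
  rw [hp.2 x _ hx (by linarith) (by linarith) (by linarith), circleDist]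
  have : |x - (x + (p.length : ℝ) / 2)| = p.length / 2 := by
    rw [sub_add_cancel_left, abs_neg, abs_of_pos (by linarith)]
  rw [this]
  refine le_min ?_ ?_ <;> nlinarith

end IsometricCycles

/-! ### Closed walks as products of conjugates of short ones -/

section Cocycles

variable {V : Type u} {Γ : SimpleGraph V} {H : Type*} [Group H] (ψ : Γ.Dart → H)

/-- The product of the values of `ψ` along a walk. -/
def walkProd {a b : V} (p : Γ.Walk a b) : H := (p.darts.map ψ).prod

@[simp]
theorem walkProd_nil (a : V) : walkProd ψ (.nil : Γ.Walk a a) = 1 := rfl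

theorem walkProd_append {a b c : V} (p : Γ.Walk a b) (q : Γ.Walk b c) :
    walkProd ψ (p.append q) = walkProd ψ p * walkProd ψ q := by
  rw [walkProd, SimpleGraph.Walk.darts_append, List.map_append, List.prod_append]
  rfl

theorem walkProd_reverse (hψ : ∀ d, ψ d.symm = (ψ d)⁻¹) {a b : V} (p : Γ.Walk a b) :
    walkProd ψ p.reverse = (walkProd ψ p)⁻¹ := by
  rw [walkProd, walkProd, SimpleGraph.Walk.darts_reverse, List.prod_inv_reverse, List.map_reverse,
    List.map_map, List.map_map]
  congr 3
  funext d
  exact hψ d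

/-- The conjugates of the values of `ψ` on closed walks of length at most `θ` by the values of `ψ`
on walks of length at most `m` that start at `x`. -/
def conjSet (θ m : ℕ) (x : V) : Set H :=
  {g | ∃ (y : V) (w : Γ.Walk x y) (c : Γ.Walk y y), w.length ≤ m ∧ 0 < c.length ∧ c.length ≤ θ ∧
    g = walkProd ψ w * walkProd ψ c * (walkProd ψ w)⁻¹}

theorem conjSet_mono {θ m m' : ℕ} (h : m ≤ m') (x : V) : conjSet ψ θ m x ⊆ conjSet ψ θ m' x := by
  rintro g ⟨y, w, c, h1, h2, h3, h4⟩
  exact ⟨y, w, c, h1.trans h, h2, h3, h4⟩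

theorem conj_mem_closure_conjSet {θ m : ℕ} {x y : V} (w : Γ.Walk x y) {g : H}
    (hg : g ∈ Subgroup.closure (conjSet ψ θ m y)) :
    walkProd ψ w * g * (walkProd ψ w)⁻¹ ∈ Subgroup.closure (conjSet ψ θ (w.length + m) x) := by
  have : Subgroup.closure (conjSet ψ θ m y) ≤
      (Subgroup.closure (conjSet ψ θ (w.length + m) x)).comap
        (MulAut.conj (walkProd ψ w)).toMonoidHom := by
    rw [Subgroup.closure_le]
    rintro g ⟨z, w', c, h1, h2, h3, rfl⟩
    refine Subgroup.subset_closure ⟨z, w.append w', c, ?_, h2, h3, ?_⟩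
    · rw [SimpleGraph.Walk.length_append]
      omega
    · rw [walkProd_append]
      simp only [MulEquiv.toMonoidHom_eq_coe, MonoidHom.coe_coe, MulAut.conj_apply]
      group
  exact this hg

/-- In a shortcut graph, a closed walk of length `n` is a product of conjugates of short closed
walks by walks of length at most `n²`. -/
theorem walkProd_mem_closure (hψ : ∀ d, ψ d.symm = (ψ d)⁻¹) (hΓ : Γ.Connected) {θ : ℕ} (hθ : 2 ≤ θ)
    (h : ∀ (v : V) (p : Γ.Walk v v), IsIsometricCycle p → p.length ≤ θ) (n : ℕ) :
    ∀ (x : V) (p : Γ.Walk x x), p.length ≤ n →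
      walkProd ψ p ∈ Subgroup.closure (conjSet ψ θ (n ^ 2) x) := by
  induction n with
  | zero =>
    intro x p hp
    cases p with
    | nil => exact one_mem _
    | cons => simp at hp
  | succ n ih =>
    intro x p hp
    by_cases hp0 : p.length = 0
    · cases p with
      | nil => exact one_mem _
      | cons => simp at hp0
    by_cases hpθ : p.length ≤ θ
    · exact Subgroup.subset_closure ⟨x, .nil, p, Nat.zero_le _, by omega, hpθ, by simp⟩
    have hniso : ¬ IsIsometricCycle p := fun h' => hpθ (h x p h')
    obtain ⟨i, j, hij, hj, hd⟩ : ∃ i j, i < j ∧ j < p.length ∧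
        Γ.dist (p.getVert i) (p.getVert j) < min (j - i) (p.length - (j - i)) := by
      by_contra! hcon
      exact hniso (isIsometricCycle_of_forall_dist p (by omega) hcon)
    obtain ⟨a, q, r, hqr, hq, hlen, ha, hr⟩ := exists_append_eq p (hij.trans hj).le
    obtain ⟨b, q', r', hqr', hq', hlen', hb, -⟩ := exists_append_eq r (i := j - i) (by omega)
    have hj' : p.getVert j = b := by rw [← hb, ← hr]; congr 1; omega
    rw [hj', ha] at hd
    -- The chord `c` is shorter than both arcs between `a` and `b`, so replacing either arc by it
    -- gives a closed walk of length at most `n`.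
    obtain ⟨c, hc⟩ := hΓ.exists_walk_length_eq_dist a b
    have h1 := ih _ (q'.append c.reverse) (by
      rw [SimpleGraph.Walk.length_append, SimpleGraph.Walk.length_reverse]
      omega)
    have h2 := ih _ ((q.append c).append r') (by
      rw [SimpleGraph.Walk.length_append, SimpleGraph.Walk.length_append]
      omega)
    have h3 := conj_mem_closure_conjSet ψ q h1
    -- The new conjugator `q` has length at most `n`, and `n + n ^ 2 ≤ (n + 1) ^ 2`.
    have hsq : (n + 1) ^ 2 = n ^ 2 + 2 * n + 1 := by ring
    have h4 := mul_mem (Subgroup.closure_mono (conjSet_mono ψ (m' := (n + 1) ^ 2) (by omega) x) h3)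
      (Subgroup.closure_mono (conjSet_mono ψ (m' := (n + 1) ^ 2) (by omega) x) h2)
    have heq : walkProd ψ p = walkProd ψ q * walkProd ψ (q'.append c.reverse) * (walkProd ψ q)⁻¹ *
        walkProd ψ ((q.append c).append r') := by
      rw [hqr, hqr']
      simp only [walkProd_append, walkProd_reverse ψ hψ]
      group
    rwa [heq]

end Cocycles

/-! ### Isodiametric functions of fillings -/

section Fillings

/-- Choosing an orientation of each geometric edge turns edge paths into words. The same choice
later serves to pick lifts compatible with edge reversal. -/
theorem exists_encoding (Y : OneComplex.{u}) : ∃ (β : Type u) (enc : Y.E → β × Bool),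
    Function.Injective enc ∧ ∀ e, enc (Y.inv e) = ((enc e).1, !(enc e).2) := by
  classical
  let r : Y.E → Y.E → Prop := fun e e' => e' = Y.inv e
  have hmk : ∀ e, Quot.mk r (Y.inv e) = Quot.mk r e := fun e =>
    Eq.symm (Quot.sound (rfl : r e (Y.inv e)))
  have hcl : ∀ e e', Quot.mk r e = Quot.mk r e' → e' = e ∨ e' = Y.inv e := by
    intro e e' h
    have := congrArg (Quot.lift (fun x => e' = x ∨ e' = Y.inv x) (by
      rintro x y rfl
      simp only [Y.inv_inv, or_comm])) h
    exact this.mpr (Or.inl rfl)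
  have hout : ∀ e, (Quot.mk r e).out = e ∨ (Quot.mk r e).out = Y.inv e := fun e =>
    hcl _ _ (Quot.out_eq _).symm
  refine ⟨Quot r, fun e => (Quot.mk r e, decide ((Quot.mk r e).out = e)), ?_, ?_⟩
  · intro e e' h
    simp only [Prod.mk.injEq] at h
    obtain ⟨h1, h2⟩ := h
    rw [← h1, decide_eq_decide] at h2
    rcases hcl e e' h1 with h | h
    · exact h.symm
    · exfalso
      subst h
      rcases hout e with h | h
      · exact Y.inv_ne e ((h2.1 h).symm.trans h)
      · exact Y.inv_ne e (h.symm.trans (h2.2 h))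
  · intro e
    simp only [hmk, Prod.mk.injEq, true_and]
    rcases hout e with h | h
    · simp [h, (Y.inv_ne e).symm]
    · simp [h, Y.inv_ne e]

theorem DiskDiagram.DiamLE.mono {X : TwoComplex.{u}} {D : DiskDiagram X} {m m' : ℕ}
    (h : D.DiamLE m) (hm : m ≤ m') : D.DiamLE m' := fun x y =>
  (h x y).imp fun _ hl => ⟨hl.1, hl.2.trans hm⟩

theorem HasPolynomialIsodiametricFunction.hasExponential {X : TwoComplex.{u}}
    (h : HasPolynomialIsodiametricFunction X) : HasExponentialIsodiametricFunction X := by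
  obtain ⟨C, k, h⟩ := h
  refine ⟨2 * C, 2 ^ k, fun n x l hl hn hp h0 => ?_⟩
  obtain ⟨D, hD, hdiam⟩ := h n x l hl hn hp h0
  refine ⟨D, hD, hdiam.mono ?_⟩
  have h1 : n ^ k ≤ (2 ^ k) ^ n := by
    rw [← pow_mul, mul_comm, pow_mul]
    exact Nat.pow_le_pow_left n.lt_two_pow_self.le k
  have h2 : 1 ≤ (2 ^ k) ^ n := Nat.one_le_pow _ _ (by positivity)
  have := Nat.mul_le_mul_left C h1
  have := Nat.mul_le_mul_left C h2
  simp only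
  linarith

theorem isPath_darts {V : Type u} {Γ : SimpleGraph V} {θ : ℕ} {a b : V} (p : Γ.Walk a b) :
    (filling Γ θ).IsPath a p.darts b := by
  induction p with
  | nil => exact rfl
  | cons h p ih => exact ⟨rfl, ih⟩

theorem exists_walk_of_isPath {V : Type u} {Γ : SimpleGraph V} {θ : ℕ} {l : List Γ.Dart} {a b : V}
    (h : (filling Γ θ).IsPath a l b) : ∃ p : Γ.Walk a b, p.darts = l := by
  induction l generalizing a with
  | nil =>
    obtain rfl : a = b := h
    exact ⟨.nil, rfl⟩
  | cons d l ih =>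
    obtain ⟨rfl, h⟩ := h
    obtain ⟨p, hp⟩ := ih h
    exact ⟨.cons d.adj p, congrArg (fun z : List Γ.Dart => d :: z) hp⟩

theorem walkProd_eq_pathWord {V : Type u} {Γ : SimpleGraph V} {β : Type*}
    (enc : Γ.Dart → β × Bool) {a b : V} (p : Γ.Walk a b) :
    walkProd (fun d => FreeGroup.mk [enc d]) p = pathWord enc p.darts := by
  induction p with
  | nil => rfl
  | cons h p ih =>
    have : pathWord enc (SimpleGraph.Walk.cons h p).darts =
      FreeGroup.mk [enc ⟨(_, _), h⟩] * pathWord enc p.darts := pathWord_append enc [_] _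
    rw [this, ← ih]
    rfl

theorem IsShortcut.hasPolynomialIsodiametricFunction {V : Type u} {Γ : SimpleGraph V}
    (h : IsShortcut Γ) : ∃ θ₀ : ℕ, ∀ θ : ℕ, θ₀ ≤ θ →
      HasPolynomialIsodiametricFunction (filling Γ θ) := by
  obtain ⟨hc, θ₀, h⟩ := h
  -- The diameter will be at most `2 * (n + n ^ 2 + θ)`, and `n ≤ n ^ 2`. The value 2 makes walks
  -- longer than `θ` long enough for the vertex criterion of isometry.
  refine ⟨max θ₀ 2, fun θ hθ => ⟨4 + 2 * θ, 2, fun n x l hl hn hlx _ => ?_⟩⟩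
  obtain ⟨β, enc, henc, hinv⟩ : ∃ (β : Type u) (enc : Γ.Dart → β × Bool),
      Function.Injective enc ∧ ∀ d, enc d.symm = ((enc d).1, !(enc d).2) :=
    exists_encoding (filling Γ θ).toOneComplex
  obtain ⟨p, rfl⟩ := exists_walk_of_isPath hlx
  have hmem := walkProd_mem_closure (fun d : Γ.Dart => FreeGroup.mk [enc d])
    (fun d => by
      rw [FreeGroup.inv_mk]
      congr 1
      simp only [FreeGroup.invRev, List.map_cons, List.map_nil, List.reverse_singleton]
      exact congrArg (fun z => [z]) (hinv d))
    hc ((le_max_right _ _).trans hθ)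
    (fun v p hp => (h v p hp).trans ((le_max_left _ _).trans hθ)) p.length x p le_rfl
  have hword : ∀ (a b : V) (q : Γ.Walk a b), walkProd (fun d : Γ.Dart => FreeGroup.mk [enc d]) q =
      pathWord enc q.darts := fun a b q => walkProd_eq_pathWord enc q
  obtain ⟨D, hD, hdiam⟩ := exists_diskDiagram_of_mem_closure (X := filling Γ θ) henc hinv (R := θ)
    (fun c => by
      obtain ⟨v, c, hc⟩ := c
      exact (SimpleGraph.Walk.length_darts c).trans_le hc.2)
    hl hlx (m := p.length ^ 2) (Subgroup.closure_mono (by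
      rintro g ⟨y, w, c, h1, h2, h3, rfl⟩
      exact ⟨w.darts, y, ⟨y, c, h2, h3⟩, isPath_darts w, isPath_darts c,
        (SimpleGraph.Walk.length_darts w).trans_le h1,
        congrArg₂ (fun a b => a * b * a⁻¹) (hword _ _ w) (hword _ _ c)⟩) ((hword _ _ p) ▸ hmem))
  refine ⟨D, hD, hdiam.mono ((congrArg (fun z => 2 * (z + p.length ^ 2 + θ))
    (SimpleGraph.Walk.length_darts p)).trans_le ?_)⟩
  replace hn : p.length ≤ n := (SimpleGraph.Walk.length_darts p).symm.trans_le hn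
  generalize p.length = N at hn ⊢
  have h1 : N ^ 2 ≤ n ^ 2 := Nat.pow_le_pow_left hn 2
  have h2 : n ≤ n ^ 2 := by nlinarith
  simp only
  nlinarith

end Fillings

/-! ### Conjugates of relators by elements of bounded length -/

section Presentations

/-- The conjugates of elements of `R` by elements of length at most `m`. -/
def boundedConj {α : Type*} [DecidableEq α] (R : Set (FreeGroup α)) (m : ℕ) : Set (FreeGroup α) :=
  {g | ∃ w r, FreeGroup.norm w ≤ m ∧ r ∈ R ∧ g = w * r * w⁻¹}

variable {α : Type*} [DecidableEq α]

theorem boundedConj_mono (R : Set (FreeGroup α)) {m m' : ℕ} (h : m ≤ m') :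
    boundedConj R m ⊆ boundedConj R m' := by
  rintro g ⟨w, r, hw, hr, rfl⟩
  exact ⟨w, r, hw.trans h, hr, rfl⟩

theorem conj_mem_closure_boundedConj {R : Set (FreeGroup α)} {m : ℕ} (w : FreeGroup α)
    {g : FreeGroup α} (hg : g ∈ Subgroup.closure (boundedConj R m)) :
    w * g * w⁻¹ ∈ Subgroup.closure (boundedConj R (FreeGroup.norm w + m)) := by
  have : Subgroup.closure (boundedConj R m) ≤
      (Subgroup.closure (boundedConj R (FreeGroup.norm w + m))).comap (MulAut.conj w).toMonoidHom := by
    rw [Subgroup.closure_le]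
    rintro g ⟨z, r, h1, h2, rfl⟩
    refine Subgroup.subset_closure ⟨w * z, r, ?_, h2, ?_⟩
    · exact (FreeGroup.norm_mul_le _ _).trans (by omega)
    · simp only [MulEquiv.toMonoidHom_eq_coe, MonoidHom.coe_coe, MulAut.conj_apply]
      group
  exact this hg

theorem exists_mem_closure_boundedConj {R : Set (FreeGroup α)} {g : FreeGroup α}
    (hg : g ∈ Subgroup.normalClosure R) : ∃ m, g ∈ Subgroup.closure (boundedConj R m) := by
  induction hg using Subgroup.closure_induction with
  | mem g hg =>
    obtain ⟨r, hr, hrg⟩ := Group.mem_conjugatesOfSet_iff.1 hg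
    obtain ⟨w, rfl⟩ := isConj_iff.1 hrg
    exact ⟨FreeGroup.norm w, Subgroup.subset_closure ⟨w, r, le_rfl, hr, rfl⟩⟩
  | one => exact ⟨0, one_mem _⟩
  | mul g h _ _ hg hh =>
    obtain ⟨m, hg⟩ := hg
    obtain ⟨m', hh⟩ := hh
    exact ⟨max m m', mul_mem
      (Subgroup.closure_mono (boundedConj_mono R (le_max_left _ _)) hg)
      (Subgroup.closure_mono (boundedConj_mono R (le_max_right _ _)) hh)⟩
  | inv g _ hg =>
    obtain ⟨m, hg⟩ := hg
    exact ⟨m, inv_mem hg⟩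

theorem closure_boundedConj_le_normalClosure (R : Set (FreeGroup α)) (m : ℕ) :
    Subgroup.closure (boundedConj R m) ≤ Subgroup.normalClosure R := by
  rw [Subgroup.closure_le]
  rintro g ⟨w, r, -, hr, rfl⟩
  exact Subgroup.normalClosure_normal.conj_mem _ (Subgroup.subset_normalClosure hr) w

/-- Replacing a finite set of relators by other relators changes the lengths of the conjugating
elements by a constant. -/
theorem exists_closure_boundedConj_le {R R' : Set (FreeGroup α)} (hR : R.Finite)
    (h : R ⊆ Subgroup.normalClosure R') : ∃ M, ∀ m,
      Subgroup.closure (boundedConj R m) ≤ Subgroup.closure (boundedConj R' (m + M)) := by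
  have : ∃ M, ∀ r ∈ R, r ∈ Subgroup.closure (boundedConj R' M) := by
    choose! f hf using fun (r : FreeGroup α) (hr : r ∈ R) =>
      exists_mem_closure_boundedConj (h hr)
    obtain ⟨M, hM⟩ := (hR.image f).bddAbove
    exact ⟨M, fun r hr => Subgroup.closure_mono
      (boundedConj_mono R' (hM (Set.mem_image_of_mem f hr))) (hf r hr)⟩
  obtain ⟨M, hM⟩ := this
  refine ⟨M, fun m => ?_⟩
  rw [Subgroup.closure_le]
  rintro g ⟨w, r, hw, hr, rfl⟩
  exact Subgroup.closure_mono (boundedConj_mono R' (by omega))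
    (conj_mem_closure_boundedConj w (hM r hr))

theorem finite_norm_le [Finite α] (B : ℕ) : {g : FreeGroup α | FreeGroup.norm g ≤ B}.Finite := by
  refine Set.Finite.of_finite_image (f := FreeGroup.toWord) ?_ FreeGroup.toWord_injective.injOn
  refine (List.finite_length_le (α × Bool) B).subset ?_
  rintro _ ⟨g, hg, rfl⟩
  exact hg

end Presentations

/-! ### Isodiametric functions of presentation complexes -/

section PresentationComplex

variable {n : ℕ} {rels : Set (FreeGroup (Fin n))}

theorem isPath_presentationComplex (x y : Unit) (l : List (Fin n × Bool)) :
    (presentationComplex rels).IsPath x l y := by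
  induction l with
  | nil => exact rfl
  | cons e l ih => exact ⟨rfl, ih⟩

theorem map_mk_eq_one_of_nullHomotopic {G : Type*} [Group G] (π : FreeGroup (Fin n) →* G)
    (hπ : ∀ r ∈ rels, π r = 1) {x : Unit} {l : List (Fin n × Bool)}
    (h : (presentationComplex rels).NullHomotopic x l) : π (FreeGroup.mk l) = 1 := by
  have key : ∀ l l' : List (Fin n × Bool),
      Relation.EqvGen ((presentationComplex rels).HomotopyStep x) l l' →
      π (FreeGroup.mk l) = π (FreeGroup.mk l') := by
    intro l l' h
    induction h with
    | rel l l' h =>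
      obtain ⟨-, -, p, q, r, rfl, rfl, h⟩ := h
      have hr : π (FreeGroup.mk r) = 1 := by
        rcases h with ⟨e, rfl⟩ | ⟨c, rfl⟩
        · have : FreeGroup.mk [e, (e.1, !e.2)] = 1 := by
            rw [FreeGroup.one_eq_mk]
            exact Quot.sound FreeGroup.Red.Step.cons_not
          exact (congrArg π this).trans (map_one π)
        · have : FreeGroup.mk c.1.toWord = c.1 := FreeGroup.mk_toWord
          exact (congrArg π this).trans (hπ _ c.2)
      have h2 : ∀ p r q : List (Fin n × Bool), FreeGroup.mk (p ++ r ++ q) =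
          FreeGroup.mk p * FreeGroup.mk r * FreeGroup.mk q := fun p r q => by
        rw [FreeGroup.mul_mk, FreeGroup.mul_mk]
      have h1 : FreeGroup.mk (p ++ q) = FreeGroup.mk p * FreeGroup.mk q := FreeGroup.mul_mk.symm
      exact (congrArg π h1).trans (Eq.symm ((congrArg π (h2 p r q)).trans (by simp [hr])))
    | refl => rfl
    | symm _ _ _ ih => exact ih.symm
    | trans _ _ _ _ _ ih1 ih2 => exact ih1.trans ih2
  rw [key l [] h, ← FreeGroup.one_eq_mk, map_one]

/-- The algebraic criterion for groups. The exponent is written `k + 1` so that `N ≤ N ^ (k + 1)`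
absorbs the length of the boundary path. -/
theorem hasPolynomialIsodiametricFunction_presentationComplex (hfin : rels.Finite) {K k : ℕ}
    (h : ∀ w ∈ Subgroup.normalClosure rels, ∀ m, w.norm ≤ m →
      w ∈ Subgroup.closure (boundedConj rels (K * m ^ (k + 1) + K))) :
    HasPolynomialIsodiametricFunction (presentationComplex rels) := by
  obtain ⟨R, hR⟩ := (hfin.image FreeGroup.norm).bddAbove
  refine ⟨2 * (1 + K + R), k + 1, fun N x l hl hn hlx h0 => ?_⟩
  have hmem := h (FreeGroup.mk l) (by
    rw [← QuotientGroup.eq_one_iff]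
    refine map_mk_eq_one_of_nullHomotopic (QuotientGroup.mk' (Subgroup.normalClosure rels))
      (fun r hr => ?_) h0
    exact (QuotientGroup.eq_one_iff r).2 (Subgroup.subset_normalClosure hr)) N
    (FreeGroup.norm_mk_le.trans hn)
  have hid : ∀ l : List (Fin n × Bool), pathWord id l = FreeGroup.mk l := fun l => by
    rw [pathWord, List.map_id]
  obtain ⟨D, hD, hdiam⟩ := exists_diskDiagram_of_mem_closure (X := presentationComplex rels)
    (enc := fun e : Fin n × Bool => e) (fun _ _ h => h) (fun e => rfl) (R := R)
    (fun c => hR ⟨c.1, c.2, rfl⟩) hl hlx (m := K * N ^ (k + 1) + K) (by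
      refine Subgroup.closure_mono ?_ ((hid l).symm ▸ hmem)
      rintro g ⟨w, r, hw, hr, rfl⟩
      refine ⟨w.toWord, x, ⟨r, hr⟩, isPath_presentationComplex _ _ _,
        isPath_presentationComplex _ _ _, hw, ?_⟩
      have h1 : pathWord id w.toWord = w := by rw [hid, FreeGroup.mk_toWord]
      have h2 : pathWord id r.toWord = r := by rw [hid, FreeGroup.mk_toWord]
      exact (congrArg₂ (fun a b => a * b * a⁻¹) h1 h2).symm)
  refine ⟨D, hD, hdiam.mono ?_⟩
  have h1 : N ≤ N ^ (k + 1) := Nat.le_self_pow (by omega) N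
  have h2 : l.length ≤ N := hn
  simp only
  nlinarith [Nat.zero_le (R * N ^ (k + 1))]

end PresentationComplex

/-! ### Lifting walks to a free group -/

section Lifts

variable {G : Type u} [Group G] {V : Type v} {Γ : SimpleGraph V}

/-- The product telescopes; in particular closed walks are sent to relations. -/
theorem map_walkProd {H : Type*} [Group H] (π : H →* G) (γ : V → G) {ψ : Γ.Dart → H}
    (hψ : ∀ d, π (ψ d) = (γ d.fst)⁻¹ * γ d.snd) {a b : V} (p : Γ.Walk a b) :
    π (walkProd ψ p) = (γ a)⁻¹ * γ b := by
  induction p with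
  | nil => simp
  | @cons a b c hab p ih =>
    have : walkProd ψ (SimpleGraph.Walk.cons hab p) = ψ ⟨(a, b), hab⟩ * walkProd ψ p :=
      List.prod_cons
    rw [this, map_mul, ih, hψ]
    simp [mul_assoc]

theorem norm_walkProd_le {α : Type*} [DecidableEq α] {ψ : Γ.Dart → FreeGroup α} {K : ℕ}
    (hψ : ∀ d, (ψ d).norm ≤ K) {a b : V} (p : Γ.Walk a b) :
    (walkProd ψ p).norm ≤ K * p.length := by
  induction p with
  | nil => simp
  | @cons a b c hab p ih =>
    have : walkProd ψ (SimpleGraph.Walk.cons hab p) = ψ ⟨(a, b), hab⟩ * walkProd ψ p :=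
      List.prod_cons
    rw [this, SimpleGraph.Walk.length_cons, mul_add, mul_one, add_comm]
    exact (FreeGroup.norm_mul_le _ _).trans (add_le_add (hψ _) ih)

/-- The section `σ` is used on one orientation of each edge and the inverse value on the other,
because `σ` itself need not respect inverses. -/
theorem exists_lift_darts {α : Type*} [DecidableEq α] (π : FreeGroup α →* G) (σ : G → FreeGroup α)
    (hσ : ∀ g, π (σ g) = g) (γ : V → G) {K : ℕ}
    (hK : ∀ a b, Γ.Adj a b → (σ ((γ a)⁻¹ * γ b)).norm ≤ K) :
    ∃ ψ : Γ.Dart → FreeGroup α, (∀ d, ψ d.symm = (ψ d)⁻¹) ∧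
      (∀ d, π (ψ d) = (γ d.fst)⁻¹ * γ d.snd) ∧ ∀ d, (ψ d).norm ≤ K := by
  obtain ⟨β, enc, -, hinv⟩ : ∃ (β : Type v) (enc : Γ.Dart → β × Bool),
      Function.Injective enc ∧ ∀ d, enc d.symm = ((enc d).1, !(enc d).2) :=
    exists_encoding (filling Γ 0).toOneComplex
  refine ⟨fun d => if (enc d).2 then σ ((γ d.fst)⁻¹ * γ d.snd) else
    (σ ((γ d.snd)⁻¹ * γ d.fst))⁻¹, fun d => ?_, fun d => ?_, fun d => ?_⟩
  · simp only [hinv]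
    cases (enc d).2 <;> simp
  · dsimp only
    split_ifs <;> simp [hσ]
  · dsimp only
    split_ifs
    · exact hK _ _ d.adj
    · exact FreeGroup.norm_inv_eq.trans_le (hK _ _ d.adj.symm)

end Lifts

/-! ### Proper cocompact actions and the transfer to groups -/

section GroupActions

variable {G : Type u} [Group G] {V : Type v} [MulAction G V] {Γ : SimpleGraph V}

theorem IsProperCocompactAction.finite_smul_eq (h : IsProperCocompactAction G Γ) (a c : V) :
    {g : G | g • a = c}.Finite := by
  rcases Set.eq_empty_or_nonempty {g : G | g • a = c} with h0 | ⟨g₀, rfl⟩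
  · rw [h0]
    exact Set.finite_empty
  · have := h.finite_stabilizer a
    refine ((Set.toFinite (MulAction.stabilizer G a : Set G)).image (g₀ * ·)).subset ?_
    intro g (hg : g • a = g₀ • a)
    refine ⟨g₀⁻¹ * g, ?_, by simp⟩
    rw [SetLike.mem_coe, MulAction.mem_stabilizer_iff, mul_smul, hg, inv_smul_smul]

/-- A coarse inverse `γ` of the orbit map of a proper and cocompact action. -/
theorem IsProperCocompactAction.exists_coarse_inverse (h : IsProperCocompactAction G Γ) (v₀ : V) :
    ∃ γ : V → G, {k | ∃ a b, Γ.Adj a b ∧ k = (γ a)⁻¹ * γ b}.Finite ∧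
      {k | ∃ g : G, k = g⁻¹ * γ (g • v₀)}.Finite := by
  obtain ⟨S, hS, hSV⟩ := h.cocompact_vertices
  obtain ⟨E, hE, hEV⟩ := h.cocompact_edges
  choose f hf using hSV
  -- As `f v` moves `v` into `S`, its inverse moves a representative to `v`. Once an edge is
  -- translated into `E`, the difference of `γ` over it is built from elements moving members of `S`
  -- to the ends of an edge in `E`; by properness these are finitely many.
  refine ⟨fun v => (f v)⁻¹, ?_, ?_⟩
  · refine (hS.biUnion fun s _ => hS.biUnion fun t _ => hE.biUnion fun e _ =>
      (h.finite_smul_eq s e.1).image2 (fun g g' => g⁻¹ * g') (h.finite_smul_eq t e.2)).subset ?_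
    rintro k ⟨a, b, hab, rfl⟩
    obtain ⟨g, hg⟩ := hEV _ _ (h.adj_smul (f a) hab)
    simp only [Set.mem_iUnion]
    refine ⟨f a • a, hf a, f b • b, hf b, _, hg, g, rfl, g * (f a * (f b)⁻¹), ?_, ?_⟩
    · change (g * (f a * (f b)⁻¹)) • f b • b = g • f a • b
      rw [mul_smul, mul_smul, inv_smul_smul]
    · group
  · refine ((hS.biUnion fun s _ => h.finite_smul_eq v₀ s).image (·⁻¹)).subset ?_
    rintro k ⟨g, rfl⟩
    refine ⟨(g⁻¹ * (f (g • v₀))⁻¹)⁻¹, ?_, inv_inv _⟩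
    simp only [Set.mem_iUnion]
    refine ⟨f (g • v₀) • g • v₀, hf _, ?_⟩
    change (g⁻¹ * (f (g • v₀))⁻¹)⁻¹ • v₀ = _
    rw [mul_inv_rev, inv_inv, inv_inv, mul_smul]

/-- Along a walk from `v₀` to `g • v₀` each edge changes `γ` by an element of the first finite set,
and the second finite set corrects `γ (g • v₀)` to `g`. -/
theorem IsProperCocompactAction.fg (h : IsProperCocompactAction G Γ) (hc : Γ.Connected) :
    Group.FG G := by
  obtain ⟨v₀⟩ := hc.nonempty
  obtain ⟨γ, h1, h2⟩ := h.exists_coarse_inverse v₀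
  rw [Group.fg_iff]
  refine ⟨_, ?_, h1.union h2⟩
  rw [eq_top_iff]
  rintro g -
  set T := {k | ∃ a b, Γ.Adj a b ∧ k = (γ a)⁻¹ * γ b} ∪ {k | ∃ g : G, k = g⁻¹ * γ (g • v₀)}
  have hT1 : ∀ a b, Γ.Adj a b → (γ a)⁻¹ * γ b ∈ Subgroup.closure T := fun a b hab =>
    Subgroup.subset_closure (Or.inl ⟨a, b, hab, rfl⟩)
  have hT2 : ∀ g : G, g⁻¹ * γ (g • v₀) ∈ Subgroup.closure T := fun g =>
    Subgroup.subset_closure (Or.inr ⟨g, rfl⟩)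
  have key : ∀ {a b : V}, Γ.Walk a b → (γ a)⁻¹ * γ b ∈ Subgroup.closure T := by
    intro a b p
    induction p with
    | nil => simp
    | @cons a b c hab p ih =>
      have := mul_mem (hT1 a b hab) ih
      simpa [mul_assoc] using this
  obtain ⟨p⟩ := hc v₀ (g • v₀)
  have := mul_mem (mul_mem (hT2 1) (key p)) (inv_mem (hT2 g))
  simpa [mul_assoc] using this

theorem IsProperCocompactAction.exists_walk (h : IsProperCocompactAction G Γ) (hc : Γ.Connected)
    (v₀ : V) {F : Set G} (hF : F.Finite) : ∃ K, ∀ g, ∀ k ∈ F,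
      ∃ p : Γ.Walk (g • v₀) ((g * k) • v₀), p.length ≤ K := by
  obtain ⟨K, hK⟩ := (hF.image fun k => Γ.dist v₀ (k • v₀)).bddAbove
  refine ⟨K, fun g k hk => ?_⟩
  obtain ⟨p, hp⟩ := hc.exists_walk_length_eq_dist v₀ (k • v₀)
  rw [mul_smul]
  let f : Γ →g Γ := ⟨fun v => g • v, fun hab => h.adj_smul g hab⟩
  refine ⟨p.map f, ?_⟩
  rw [SimpleGraph.Walk.length_map, hp]
  exact hK ⟨k, hk, rfl⟩

/-- For a finitely generated group acting properly and cocompactly on a shortcut graph, finitely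
many relators suffice, with conjugating elements of quadratic length. -/
theorem IsShortcut.exists_finite_relators (hs : IsShortcut Γ) (h : IsProperCocompactAction G Γ)
    {n : ℕ} (π : FreeGroup (Fin n) →* G) (hπ : Function.Surjective π) :
    ∃ (R : Set (FreeGroup (Fin n))) (K : ℕ), R.Finite ∧ (∀ r ∈ R, π r = 1) ∧
      ∀ w, π w = 1 → ∀ m, w.norm ≤ m →
        w ∈ Subgroup.closure (boundedConj R (K * m ^ 2 + K)) := by
  obtain ⟨hc, θ₀, hθ₀⟩ := hs
  obtain ⟨v₀⟩ := hc.nonempty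
  obtain ⟨γ, hF1, hF2⟩ := h.exists_coarse_inverse v₀
  obtain ⟨σ, hσ⟩ := hπ.hasRightInverse
  obtain ⟨K₁, hK₁⟩ := ((hF1.union hF2).image fun g => (σ g).norm).bddAbove
  obtain ⟨ψ, hψ1, hψ2, hψ3⟩ := exists_lift_darts (Γ := Γ) π σ hσ γ (K := K₁)
    (fun a b hab => hK₁ ⟨_, Or.inl ⟨a, b, hab, rfl⟩, rfl⟩)
  have hs : ∀ g, (σ (g⁻¹ * γ (g • v₀))).norm ≤ K₁ := fun g => hK₁ ⟨_, Or.inr ⟨g, rfl⟩, rfl⟩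
  obtain ⟨K₂, hK₂⟩ := h.exists_walk hc v₀
    (Set.finite_range fun a : Fin n × Bool => π (FreeGroup.mk [a]))
  set θ := max θ₀ 2
  -- The first bound admits lifts of closed walks of length at most `θ`; the second admits the
  -- squares comparing one letter with the walk it spans.
  set R := {r : FreeGroup (Fin n) | π r = 1 ∧ r.norm ≤ max (K₁ * θ) (1 + 2 * K₁ + K₁ * K₂)}
  refine ⟨R, 1 + K₁ + K₁ * K₂ ^ 2, (finite_norm_le _).subset fun r hr => hr.2, fun r hr => hr.1, ?_⟩
  -- A word equals the lift of a walk shadowing its orbit path, up to correction terms at both ends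
  -- and conjugates of relators by prefixes of the word. The endpoint is a variable `z` so that it
  -- can be `v₀` itself when the word is trivial in `G`.
  have key : ∀ (L : List (Fin n × Bool)) (z : V), z = π (FreeGroup.mk L) • v₀ →
      ∃ p : Γ.Walk v₀ z, p.length ≤ K₂ * L.length ∧
        FreeGroup.mk L * σ ((π (FreeGroup.mk L))⁻¹ * γ (π (FreeGroup.mk L) • v₀)) *
          (walkProd ψ p)⁻¹ * (σ (1⁻¹ * γ ((1 : G) • v₀)))⁻¹ ∈
            Subgroup.closure (boundedConj R L.length) := by
    intro L
    induction L using List.reverseRecOn with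
    | nil =>
      intro z hz
      rw [← FreeGroup.one_eq_mk, map_one] at hz ⊢
      obtain rfl : z = v₀ := hz.trans (one_smul G v₀)
      exact ⟨.nil, Nat.zero_le _, by simp⟩
    | append_singleton L a ih =>
      intro z hz
      obtain ⟨p, hp, hmem⟩ := ih _ rfl
      obtain ⟨q, hq⟩ : ∃ q : Γ.Walk (π (FreeGroup.mk L) • v₀)
          ((π (FreeGroup.mk L) * π (FreeGroup.mk [a])) • v₀), q.length ≤ K₂ := hK₂ _ _ ⟨a, rfl⟩
      have hLa : FreeGroup.mk (L ++ [a]) = FreeGroup.mk L * FreeGroup.mk [a] :=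
        FreeGroup.mul_mk.symm
      rw [hLa, map_mul] at hz ⊢
      subst hz
      have hLn : (FreeGroup.mk L).norm ≤ L.length := FreeGroup.norm_mk_le
      have han : (FreeGroup.mk [a]).norm ≤ 1 := FreeGroup.norm_mk_le
      generalize FreeGroup.mk L = x at *
      generalize FreeGroup.mk [a] = y at *
      refine ⟨p.append q, ?_, ?_⟩
      · rw [SimpleGraph.Walk.length_append, List.length_append, List.length_singleton, mul_add,
          mul_one]
        exact add_le_add hp hq
      · set r := y * σ ((π x * π y)⁻¹ * γ ((π x * π y) • v₀)) * (walkProd ψ q)⁻¹ *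
          (σ ((π x)⁻¹ * γ (π x • v₀)))⁻¹ with hr
        have hrR : r ∈ R := by
          constructor
          · rw [hr]
            simp only [map_mul, map_inv, hσ _, map_walkProd π γ hψ2]
            group
          · refine le_trans ?_ (le_max_right _ _)
            have h1 := FreeGroup.norm_mul_le (y * σ ((π x * π y)⁻¹ * γ ((π x * π y) • v₀)) *
              (walkProd ψ q)⁻¹) (σ ((π x)⁻¹ * γ (π x • v₀)))⁻¹
            have h2 := FreeGroup.norm_mul_le (y * σ ((π x * π y)⁻¹ * γ ((π x * π y) • v₀)))
              (walkProd ψ q)⁻¹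
            have h3 := FreeGroup.norm_mul_le y (σ ((π x * π y)⁻¹ * γ ((π x * π y) • v₀)))
            have h4 := (norm_walkProd_le hψ3 q).trans (Nat.mul_le_mul_left K₁ hq)
            have h5 := hs (π x * π y)
            have h6 := hs (π x)
            rw [FreeGroup.norm_inv_eq] at h1 h2
            rw [hr]
            omega
        have h1 : x * r * x⁻¹ ∈ Subgroup.closure (boundedConj R (L ++ [a]).length) :=
          Subgroup.subset_closure ⟨x, r, hLn.trans (by simp), hrR, rfl⟩
        have h2 := Subgroup.closure_mono
          (boundedConj_mono R (by simp : L.length ≤ (L ++ [a]).length)) hmem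
        convert mul_mem h1 h2 using 1
        rw [hr, walkProd_append]
        group
  intro w hw m hm
  obtain ⟨p, hp, hmem⟩ := key w.toWord v₀ (by rw [FreeGroup.mk_toWord, hw, one_smul])
  rw [FreeGroup.mk_toWord, hw] at hmem
  have hp' : p.length ≤ K₂ * m := hp.trans (Nat.mul_le_mul_left _ hm)
  -- As `π w = 1`, the shadowing walk is closed, of length at most `K₂ * m`. Its decomposition has
  -- conjugators of length at most `K₁ * (K₂ * m) ^ 2`, and the correction term at `v₀` adds at most
  -- `K₁`.
  have hpm := walkProd_mem_closure ψ hψ1 hc (le_max_right θ₀ 2)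
    (fun v p hp => (hθ₀ v p hp).trans (le_max_left _ _)) p.length v₀ p le_rfl
  have hpm' : walkProd ψ p ∈ Subgroup.closure (boundedConj R (K₁ * (K₂ * m) ^ 2)) := by
    refine Subgroup.closure_mono ?_ hpm
    rintro g ⟨y, w, c, h1, h2, h3, rfl⟩
    refine ⟨walkProd ψ w, walkProd ψ c, ?_, ⟨?_, ?_⟩, rfl⟩
    · exact (norm_walkProd_le hψ3 w).trans
        (Nat.mul_le_mul_left _ (h1.trans (Nat.pow_le_pow_left hp' 2)))
    · rw [map_walkProd π γ hψ2, inv_mul_cancel]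
    · exact (norm_walkProd_le hψ3 c).trans
        ((Nat.mul_le_mul_left _ h3).trans (le_max_left _ _))
  have h1 := conj_mem_closure_boundedConj (σ (1⁻¹ * γ ((1 : G) • v₀))) hpm'
  have hmm : m ≤ m ^ 2 := Nat.le_self_pow (by omega) m
  have h2 := mul_mem
    (Subgroup.closure_mono (boundedConj_mono R (m' := (1 + K₁ + K₁ * K₂ ^ 2) * m ^ 2 +
      (1 + K₁ + K₁ * K₂ ^ 2)) ?_) hmem)
    (Subgroup.closure_mono (boundedConj_mono R ?_) h1)
  · convert h2 using 1
    group
  · have : w.toWord.length ≤ m := hm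
    nlinarith [Nat.zero_le (K₁ * m ^ 2), Nat.zero_le (K₁ * K₂ ^ 2 * m ^ 2),
      Nat.zero_le (K₁ * K₂ ^ 2)]
  · have := hs 1
    rw [mul_pow]
    nlinarith [Nat.zero_le (K₁ * m ^ 2), Nat.zero_le (K₁ * K₂ ^ 2)]

theorem IsShortcutGroup.hasPolynomialIsodiametricFunction (hG : IsShortcutGroup G) :
    GroupHasPolynomialIsodiametricFunction G := by
  obtain ⟨V, _, Γ, hs, h⟩ := hG
  have hker : ∀ {n : ℕ} {π : FreeGroup (Fin n) →* G} {R : Set (FreeGroup (Fin n))} {K : ℕ},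
      (∀ r ∈ R, π r = 1) →
      (∀ w, π w = 1 → ∀ m, w.norm ≤ m → w ∈ Subgroup.closure (boundedConj R (K * m ^ 2 + K))) →
      Subgroup.normalClosure R = π.ker := by
    intro n π R K h1 h2
    refine le_antisymm (Subgroup.normalClosure_le_normal h1) fun w hw => ?_
    exact closure_boundedConj_le_normalClosure R _ (h2 w hw _ le_rfl)
  constructor
  · have := h.fg hs.1
    obtain ⟨α, hα, φ, hφ⟩ := Group.fg_iff_exists_freeGroup_hom_surjective_finite.1 this
    obtain ⟨n, ⟨e⟩⟩ := Finite.exists_equiv_fin α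
    have hπ : Function.Surjective (φ.comp (FreeGroup.freeGroupCongr e.symm).toMonoidHom) :=
      hφ.comp (FreeGroup.freeGroupCongr e.symm).surjective
    obtain ⟨R, K, hR, h1, h2⟩ := hs.exists_finite_relators h _ hπ
    exact ⟨n, _, hπ, R, hR, hker h1 h2⟩
  · rintro n rels ⟨hfin, ⟨e⟩⟩
    have hπ : Function.Surjective (e.toMonoidHom.comp (PresentedGroup.mk rels)) :=
      e.surjective.comp (PresentedGroup.mk_surjective rels)
    have hπ1 : ∀ w, (e.toMonoidHom.comp (PresentedGroup.mk rels)) w = 1 ↔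
        w ∈ Subgroup.normalClosure rels := fun w =>
      (map_eq_one_iff e e.injective).trans PresentedGroup.mk_eq_one_iff
    obtain ⟨R, K, hR, h1, h2⟩ := hs.exists_finite_relators h _ hπ
    -- `R` depends on the action; rewriting it in terms of the given relators lengthens conjugators
    -- by the constant `M`.
    obtain ⟨M, hM⟩ := exists_closure_boundedConj_le hR (R' := rels) fun r hr =>
      (hπ1 r).1 (h1 r hr)
    refine hasPolynomialIsodiametricFunction_presentationComplex hfin (K := K + M) (k := 1)
      fun w hw m hm => ?_
    refine Subgroup.closure_mono (boundedConj_mono rels ?_) (hM _ (h2 w ((hπ1 w).2 hw) m hm))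
    have : (K + M) * m ^ (1 + 1) = K * m ^ 2 + M * m ^ 2 := add_mul _ _ _
    omega

theorem GroupHasPolynomialIsodiametricFunction.hasExponential
    (h : GroupHasPolynomialIsodiametricFunction G) : GroupHasExponentialIsodiametricFunction G :=
  ⟨h.1, fun n rels hr => (h.2 n rels hr).hasExponential⟩

theorem IsStronglyShortcutGroup.isShortcutGroup (h : IsStronglyShortcutGroup G) :
    IsShortcutGroup G := by
  obtain ⟨V, i, Γ, hs, h⟩ := h
  exact ⟨V, i, Γ, hs.isShortcut, h⟩

end GroupActions

end ShortcutGraph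

theorem mainTheorem3 :
    (∀ (V : Type u) (Γ : SimpleGraph V),
      (ShortcutGraph.IsShortcut Γ → ∃ θ₀ : ℕ, ∀ θ : ℕ, θ₀ ≤ θ →
        ShortcutGraph.HasExponentialIsodiametricFunction (ShortcutGraph.filling Γ θ)) ∧
      (ShortcutGraph.IsStronglyShortcut Γ → ∃ θ₀ : ℕ, ∀ θ : ℕ, θ₀ ≤ θ →
        ShortcutGraph.HasPolynomialIsodiametricFunction (ShortcutGraph.filling Γ θ))) ∧
    (∀ (G : Type v) [Group G],
      (ShortcutGraph.IsShortcutGroup G →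
        ShortcutGraph.GroupHasExponentialIsodiametricFunction G) ∧
      (ShortcutGraph.IsStronglyShortcutGroup G →
        ShortcutGraph.GroupHasPolynomialIsodiametricFunction G)) := by
  refine ⟨fun V Γ => ⟨fun h => ?_, fun h => ?_⟩, fun G _ => ⟨fun h => ?_, fun h => ?_⟩⟩
  · obtain ⟨θ₀, h⟩ := h.hasPolynomialIsodiametricFunction
    exact ⟨θ₀, fun θ hθ => (h θ hθ).hasExponential⟩
  · exact h.isShortcut.hasPolynomialIsodiametricFunction
  · exact h.hasPolynomialIsodiametricFunction.hasExponential
  · exact h.isShortcutGroup.hasPolynomialIsodiametricFunction
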